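/- **Conventions.** For a prime $p$ let $\mathbb Z_p=\mathbb Z/p\mathbb Z$. At a crossing of a knot diagram $D$ let $x_1,x_2,x_3,x_4$ be the four surrounding regions, with $x_2$ adjacent to $x_1$ across an under-arc, $x_3$ adjacent to $x_1$ across the over-arc, and $x_4$ opposite to $x_1$. A *Dehn $p$-coloring* of $D$ is a map $C$ from the set of regions of $D$ to $\mathbb Z_p$ with $C(x_1)+C(x_3)=C(x_2)+C(x_4)$ at every crossing. It is *nontrivial* if at some crossing it is not the case that both $C(x_1)=C(x_4)$ and $C(x_2)=C(x_3)$. Write $\mathcal C(D,C)=\operatorname{Im} C$. A knot $K$ is *Dehn $p$-colorable* if some diagram of $K$ has a nontrivial Dehn $p$-coloring, and then $\mathrm{mincol}^{\mathrm{Dehn}}_p(K)$ is the minimum of $\#\mathcal C(D,C)$ over all diagrams $D$ of $K$ and all nontrivial Dehn $p$-colorings $C$ of $D$. Subsets $S,S'\subset\mathbb Z_p$ are *affine equivalent*, $S\sim S'$, if $S'=sS+t$ for some $s\in\mathbb Z_p^\times$, $t\in\mathbb Z_p$. For $p$ odd and $S\subset\mathbb Z_p$, the *$\mathcal R$-palette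 graph* $G_S$ is the simple graph with vertex set $\{a_1+a_2 : a_1,a_2\in S\}\subset\mathbb Z_p$ ($a_1=a_2$ allowed), in which distinct vertices $b_1,b_2$ are adjacent if and only if there are $a_1,a_2,a_3,a_4\in S$ with $a_1+a_2=b_1$, $a_3+a_4=b_2$ and ($a_1+a_3=a_2+a_4$ or $a_1+a_4=a_2+a_3$). The edge $b_1b_2$ has the label $2^{-1}(b_1+b_2)$. An *$\mathcal R$-subgraph* of $G_S$ is a subgraph that contains, for each of its edges, the label of that edge as a vertex. **Theorem.** Let $p$ be an odd prime number with $p<2^5$. (1) There is no subset $S\subset\mathbb Z_p$ with at most $\lfloor\log_2 p\rfloor+1$ elements such that $G_S$ includes a connected $\mathcal R$-subgraph with at least three vertices; and $\mathrm{mincol}^{\mathrm{Dehn}}_p(K)\ge\lfloor\log_2 p\rfloor+2$ for every Dehn $p$-colorable knot $K$. (2) If $D$ is a knot diagram with a nontrivial Dehn $p$-coloring $C$ such that $\#\mathcal C(D,C)=\lfloor\log_2 p\rfloor+2$, then $\mathcal C(D,C)$ is affine equivalent to one of the following sets: - $p=3$: $\{0,1,2\}$; - $p=5$: $\{0,1,2,3\}$;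 - $p=7$: $\{0,1,2,4\}$; - $p=11$: $\{0,1,2,3,6\}$, $\{0,1,2,4,7\}$; - $p=13$: $\{0,1,2,4,7\}$; - $p=17$: $\{0,1,2,3,5,9\}$, $\{0,1,2,3,5,10\}$, $\{0,1,2,3,5,12\}$, $\{0,1,2,3,6,9\}$, $\{0,1,2,3,6,10\}$, $\{0,1,2,3,6,11\}$, $\{0,1,2,3,6,13\}$, $\{0,1,2,3,7,11\}$, $\{0,1,2,4,5,9\}$, $\{0,1,2,4,5,10\}$, $\{0,1,2,4,5,12\}$, $\{0,1,2,4,10,13\}$; - $p=19$: $\{0,1,2,3,5,10\}$, $\{0,1,2,3,6,10\}$, $\{0,1,2,3,6,11\}$, $\{0,1,2,3,6,12\}$, $\{0,1,2,3,6,13\}$, $\{0,1,2,3,6,14\}$, $\{0,1,2,3,7,12\}$, $\{0,1,2,4,5,10\}$, $\{0,1,2,4,5,14\}$, $\{0,1,2,4,7,12\}$, $\{0,1,2,4,7,15\}$; - $p=23$: $\{0,1,2,3,6,12\}$, $\{0,1,2,4,7,12\}$, $\{0,1,2,4,7,13\}$, $\{0,1,2,4,7,14\}$, $\{0,1,2,4,9,14\}$,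 $\{0,1,2,4,10,19\}$; - $p=29$: $\{0,1,2,4,8,15\}$; - $p=31$: $\{0,1,2,4,8,16\}$. -/

import Mathlib

/-! ### Knot diagrams

A diagram is recorded by its crossings and the way in which their four ends are joined by
semiarcs, in the oriented sphere.  The four ends (darts) at a crossing are numbered
counterclockwise by `ZMod 4`; `0, 2` are the ends of the under-strand and `1, 3` those of the
over-strand. -/

/-- The ends of the strands at `n` crossings. -/
abbrev Dart (n : ℕ) : Type := Fin n × ZMod 4

namespace Dart

variable {n : ℕ}

/-- The next end counterclockwise at the same crossing. -/
def rot : Equiv.Perm (Dart n) := (Equiv.refl (Fin n)).prodCongr (Equiv.addRight (1 : ZMod 4))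

/-- The opposite end of the same strand at the same crossing. -/
def opp (d : Dart n) : Dart n := rot (rot d)

/-- The end belongs to the over-strand. -/
def IsOver (d : Dart n) : Prop := d.2 = 1 ∨ d.2 = 3

/-- If `glue` joins each end to the other end of its semiarc, then `faceNext glue d` is the
semiarc following `d` along the boundary of the region to the left of `d` (a semiarc is traversed
from `d` to `glue d`, and then one turns left). -/
def faceNext (glue : Equiv.Perm (Dart n)) : Equiv.Perm (Dart n) := glue.trans rot.symm

/-- The regions of a diagram with connected projection: the cycles of `faceNext`, that is, the
closed boundary walks with the region on the left.  A circle without crossings has two regions. -/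
def Region (glue : Equiv.Perm (Dart n)) : Type :=
  Quotient (Equiv.Perm.SameCycle.setoid (faceNext glue)) ⊕ {_i : Fin 2 // n = 0}

end Dart

/-- A knot diagram. -/
structure KnotDiagram where
  /-- The number of crossings. -/
  crossings : ℕ
  /-- Each end is joined by a semiarc to the end `glue d`. -/
  glue : Equiv.Perm (Dart crossings)
  glue_glue : ∀ d, glue (glue d) = d
  glue_ne : ∀ d, glue d ≠ d
  /-- The diagram has one component: following a strand along semiarcs and straight through
  crossings one meets every end. -/
  one_component : ∀ d d',
    Relation.ReflTransGen (fun x y => y = glue x ∨ y = Dart.opp x) d d'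
  /-- The projection lies in the sphere: with `n` vertices and `2n` edges, Euler's formula reads
  `n - 2n + #regions = 2`. -/
  planar : Nat.card (Dart.Region glue) = crossings + 2

namespace KnotDiagram

open Dart

/-- The regions of a diagram. -/
def Region (D : KnotDiagram) : Type := Dart.Region D.glue

/-- The region to the left of an end `d`, looking away from its crossing: it occupies the sector
between `d` and `rot d` at that crossing. -/
def regionAt (D : KnotDiagram) (d : Dart D.crossings) : D.Region :=
  Sum.inl (Quotient.mk (Equiv.Perm.SameCycle.setoid (faceNext D.glue)) d)

/-! The regions `x₁, x₂, x₃, x₄` around a crossing: `x₂` is separated from `x₁` by the under-end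
`0`, `x₃` is separated from `x₁` by the over-end `1`, and `x₄` is opposite to `x₁`. -/

/-- The first region around a crossing. -/
def x₁ (D : KnotDiagram) (c : Fin D.crossings) : D.Region := D.regionAt (c, 0)

/-- The region adjacent to `x₁` by an under-arc. -/
def x₂ (D : KnotDiagram) (c : Fin D.crossings) : D.Region := D.regionAt (c, 3)

/-- The region adjacent to `x₁` by the over-arc. -/
def x₃ (D : KnotDiagram) (c : Fin D.crossings) : D.Region := D.regionAt (c, 1)

/-- The region opposite to `x₁`. -/
def x₄ (D : KnotDiagram) (c : Fin D.crossings) : D.Region := D.regionAt (c, 2)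

/-- Dehn `p`-colorings of a diagram. -/
def IsDehnColoring (D : KnotDiagram) {p : ℕ} (C : D.Region → ZMod p) : Prop :=
  ∀ c, C (D.x₁ c) + C (D.x₃ c) = C (D.x₂ c) + C (D.x₄ c)

/-- A crossing is trivially colored. -/
def IsTrivialAt (D : KnotDiagram) {p : ℕ} (C : D.Region → ZMod p) (c : Fin D.crossings) : Prop :=
  C (D.x₁ c) = C (D.x₄ c) ∧ C (D.x₃ c) = C (D.x₂ c)

/-- Nontrivial Dehn `p`-colorings: some crossing is nontrivially colored. -/
def IsNontrivialDehnColoring (D : KnotDiagram) {p : ℕ} (C : D.Region → ZMod p) : Prop :=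
  D.IsDehnColoring C ∧ ¬ ∀ c, D.IsTrivialAt C c

/-! ### Reidemeister moves and knots -/

/-- `D.StraightTo X d x`: leaving `d` along its semiarc and going straight through crossings that
belong to `X`, one arrives at the end `x`. -/
inductive StraightTo (D : KnotDiagram) (X : Set (Fin D.crossings)) (d : Dart D.crossings) :
    Dart D.crossings → Prop
  | base : StraightTo D X d (D.glue d)
  | step (x : Dart D.crossings) :
      StraightTo D X d x → x.1 ∈ X → StraightTo D X d (D.glue (opp x))

/-- `D'` is `D` with the crossings in `X` erased, the strands through them being joined straight
on; `ι` identifies the ends in `D'` with the remaining ends in `D`. -/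
def IsErasure (D D' : KnotDiagram) (X : Set (Fin D.crossings)) : Prop :=
  ∃ ι : Dart D'.crossings → Dart D.crossings,
    Function.Injective ι ∧ (∀ y, ι (rot y) = rot (ι y)) ∧ (∀ y, IsOver (ι y) ↔ IsOver y) ∧
    (∀ x, x ∈ Set.range ι ↔ x.1 ∉ X) ∧ ∀ y, D.StraightTo X (ι y) (ι (D'.glue y))

/-- Isotopy of diagrams on the sphere: nothing is erased, only crossings and ends are renamed. -/
def Isotopic (D D' : KnotDiagram) : Prop := D.IsErasure D' ∅

/-- First move: the crossing at a region with one side is removed. -/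
def Reidemeister1 (D D' : KnotDiagram) : Prop :=
  ∃ d, D.glue d = rot d ∧ D.IsErasure D' {d.1}

/-- Second move: the two crossings at a region with two sides, one of which is over at both of its
ends, are removed. -/
def Reidemeister2 (D D' : KnotDiagram) : Prop :=
  ∃ d, faceNext D.glue (faceNext D.glue d) = d ∧ (D.glue d).1 ≠ d.1 ∧
    IsOver d ∧ IsOver (D.glue d) ∧ D.IsErasure D' {d.1, (D.glue d).1}

/-- The ends of the sides of a triangular region with the side `d`. -/
def triangleEnds (D : KnotDiagram) (d : Dart D.crossings) : Set (Dart D.crossings) :=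
  let d₁ := faceNext D.glue d
  let d₂ := faceNext D.glue d₁
  {d, d₁, d₂, D.glue d, D.glue d₁, D.glue d₂}

open Classical in
/-- For a triangular region with the side `d`, each of the three strands bounding it runs through
ends `y, opp y, glue (opp y), opp (glue (opp y))`, the middle two being those of a side.
This map exchanges the first with the third and the second with the fourth of these ends. -/
noncomputable def triangleSwap (D : KnotDiagram) (d x : Dart D.crossings) : Dart D.crossings :=
  if x ∈ D.triangleEnds d then opp (D.glue x)
  else if opp x ∈ D.triangleEnds d then D.glue (opp x)
  else x

/-- Third move: at a triangular region with three distinct crossings, one side of which is over at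
both of its ends, each of the three strands is made to meet the other two in the opposite order. -/
def Reidemeister3 (D D' : KnotDiagram) : Prop :=
  ∃ d, faceNext D.glue (faceNext D.glue (faceNext D.glue d)) = d ∧
    (faceNext D.glue d).1 ≠ d.1 ∧ (faceNext D.glue (faceNext D.glue d)).1 ≠ d.1 ∧
    (faceNext D.glue (faceNext D.glue d)).1 ≠ (faceNext D.glue d).1 ∧
    IsOver d ∧ IsOver (D.glue d) ∧
    ∃ ι : Dart D'.crossings → Dart D.crossings,
      Function.Bijective ι ∧ (∀ y, ι (rot y) = rot (ι y)) ∧ (∀ y, IsOver (ι y) ↔ IsOver y) ∧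
      ∀ y, ι (D'.glue y) = D.triangleSwap d (D.glue (D.triangleSwap d (ι y)))

/-- One step of the equivalence of diagrams. -/
def Move (D D' : KnotDiagram) : Prop :=
  D.Isotopic D' ∨ D.Reidemeister1 D' ∨ D.Reidemeister2 D' ∨ D.Reidemeister3 D'

end KnotDiagram

/-- A knot: a class of knot diagrams under the equivalence generated by isotopy and the
Reidemeister moves. -/
def Knot : Type := Quotient (Relation.EqvGen.setoid KnotDiagram.Move)

/-- `D` is a diagram of the knot `K`. -/
def KnotDiagram.IsDiagramOf (D : KnotDiagram) (K : Knot) : Prop :=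
  Quotient.mk (Relation.EqvGen.setoid KnotDiagram.Move) D = K

/-- `K` has a nontrivially Dehn `p`-colored diagram. -/
def Knot.IsDehnColorable (p : ℕ) (K : Knot) : Prop :=
  ∃ D : KnotDiagram, D.IsDiagramOf K ∧ ∃ C : D.Region → ZMod p, D.IsNontrivialDehnColoring C

/-- The minimum number of colors of `K` for Dehn `p`-colorings (of interest for `K` Dehn
`p`-colorable, when the set is nonempty). -/
noncomputable def Knot.mincolDehn (p : ℕ) (K : Knot) : ℕ :=
  sInf {m | ∃ D : KnotDiagram, D.IsDiagramOf K ∧ ∃ C : D.Region → ZMod p,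
    D.IsNontrivialDehnColoring C ∧ (Set.range C).ncard = m}

/-! ### Palette graphs -/

/-- Two subsets of `ZMod p` are affine equivalent. -/
def AffineEquivalent {p : ℕ} (S S' : Set (ZMod p)) : Prop :=
  ∃ (s : (ZMod p)ˣ) (t : ZMod p), S' = (fun a => (s : ZMod p) * a + t) '' S

/-- The vertices of the palette graph: the class of the multiset `{a₁, a₂}` is identified with the
sum `a₁ + a₂` that determines it. -/
def paletteVertices {p : ℕ} (S : Set (ZMod p)) : Set (ZMod p) :=
  {b | ∃ a₁ ∈ S, ∃ a₂ ∈ S, a₁ + a₂ = b}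

/-- The `R`-palette graph of `S`. -/
def paletteGraph {p : ℕ} (S : Set (ZMod p)) : SimpleGraph (paletteVertices S) where
  Adj b₁ b₂ := b₁ ≠ b₂ ∧ ∃ a₁ ∈ S, ∃ a₂ ∈ S, ∃ a₃ ∈ S, ∃ a₄ ∈ S,
    a₁ + a₂ = b₁ ∧ a₃ + a₄ = b₂ ∧ (a₁ + a₃ = a₂ + a₄ ∨ a₁ + a₄ = a₂ + a₃)
  symm := ⟨by
    rintro b₁ b₂ ⟨hne, a₁, h₁, a₂, h₂, a₃, h₃, a₄, h₄, e₁, e₂, h⟩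
    refine ⟨hne.symm, a₃, h₃, a₄, h₄, a₁, h₁, a₂, h₂, e₂, e₁, ?_⟩
    rcases h with h | h
    · exact Or.inl (by rw [add_comm a₃, add_comm a₄, h])
    · exact Or.inr (by rw [add_comm a₃, add_comm a₄, h])⟩
  loopless := ⟨fun _ h => h.1 rfl⟩

/-- A subgraph of the palette graph is an `R`-subgraph if it contains, for every edge
`b₁ b₂`, the vertex given by the label `2⁻¹ (b₁ + b₂)` of the edge. -/
def IsRSubgraph {p : ℕ} {S : Set (ZMod p)} (H : (paletteGraph S).Subgraph) : Prop :=
  ∀ b₁ b₂, H.Adj b₁ b₂ → ∃ b ∈ H.verts, (b : ZMod p) = 2⁻¹ * ((b₁ : ZMod p) + (b₂ : ZMod p))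

/-- The palette graph of `S` includes a connected `R`-subgraph with at least three vertices. -/
def HasConnectedRSubgraph {p : ℕ} (S : Set (ZMod p)) : Prop :=
  ∃ H : (paletteGraph S).Subgraph, IsRSubgraph H ∧ H.Connected ∧ 3 ≤ H.verts.ncard

/-! Give every semiarc the sum of the colors of the two regions beside it (`dartColor`). At a
crossing the Dehn condition says that both over-ends have the sum x₁ + x₃, which is the mean of the
sums x₁ + x₂ and x₃ + x₄ at the under-ends. So the sums form a Fox coloring, and each crossing gives
an edge (or a loop) on sums of elements of S = Im C whose label is again one of these sums. A knot
has one component, so the set V of all sums is not split by any set that splits no such edge; V has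
two elements because the coloring is nontrivial. This property of S is `HasLinkedPalette`. The
vertices of a connected R-subgraph give it too, so both parts of the theorem reduce to finding the
sets of a given size that have a linked palette (`LinkedPalettesListed`).

The property passes to supersets, so the lower bound needs only sets of one size, and to affine
images. A set with a three-term progression can be moved so that it contains 0, 1, 2; any other set
with two elements, so that it contains 0, 1. The other elements are found by exhaustive search
(`search_spec`), which in the second case discards elements completing a progression. In the first
case every set is refuted or is an affine image of a listed one; in the second all are refuted.

To refute one set (`not_linked_of_grow`), take a component A of the graph. Then V lies inside A or
outside it, and in either case the edges on the other side, and those whose label is there, may be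
dropped. If repeating this in all cases leaves no edges, no V with two elements exists. The kernel
evaluates these tests for each prime. -/

/-! ### Masks and linked sets

A natural number stands for the set of positions of its binary ones. A pair `(m, l)` stands for an
edge whose ends form the set `m` and whose label is the element of `l`. -/

/-- The positions of the binary ones. -/
def bits (m : ℕ) : Set ℕ := {i | m.testBit i = true}

theorem disjoint_bits {a b : ℕ} : Disjoint (bits a) (bits b) ↔ Nat.land a b = 0 := by
  rw [Set.disjoint_left]
  constructor
  · intro h
    refine Nat.eq_of_testBit_eq fun i => ?_
    have := @h i
    change (a &&& b).testBit i = _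
    rw [Nat.testBit_and, Nat.zero_testBit]
    simp only [bits, Set.mem_ofPred_eq] at this
    grind
  · intro h i hi hj
    have h' : (a &&& b).testBit i = (0 : ℕ).testBit i := by rw [← h]; rfl
    rw [Nat.testBit_and, Nat.zero_testBit] at h'
    simp only [bits, Set.mem_ofPred_eq] at hi hj
    simp [hi, hj] at h'

theorem bits_lor (a b : ℕ) : bits (Nat.lor a b) = bits a ∪ bits b := by
  ext i
  change (a ||| b).testBit i = true ↔ _
  simp [bits, Nat.testBit_or]

theorem bits_shiftLeft (x : ℕ) : bits (Nat.shiftLeft 1 x) = {x} := by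
  ext i
  change (1 <<< x).testBit i = true ↔ _
  rw [Nat.one_shiftLeft, Nat.testBit_two_pow]
  simp [eq_comm]

theorem bits_zero : bits 0 = ∅ := by
  ext i
  simp [bits]

/-- Case analysis on `n` makes the kernel evaluate it before `k` receives it, so unevaluated terms
do not pile up. The value at zero is harmless: `false` is never used to prove anything. -/
theorem forced_eq_true {n : ℕ} {k : ℕ → Bool}
    (h : @Nat.rec (fun _ => Bool) false (fun m _ => k (Nat.succ m)) n = true) : k n = true := by
  cases n with
  | zero => exact absurd h (by simp)
  | succ n => exact h

/-- A set of vertices is linked by a list of edges if it cannot be separated by a set that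
separates the ends of none of the edges that have their ends and their label in it. -/
def Linked (E : List (ℕ × ℕ)) (V : Set ℕ) : Prop :=
  ∀ A : Set ℕ, (∀ e ∈ E, bits e.1 ⊆ V → bits e.2 ⊆ V → (bits e.2).Nonempty →
    bits e.1 ⊆ A ∨ Disjoint (bits e.1) A) → V ⊆ A ∨ Disjoint V A

/-- More edges leave fewer test sets `A`. -/
theorem Linked.mono {E E' : List (ℕ × ℕ)} {V : Set ℕ} (h : Linked E V)
    (hE : ∀ e ∈ E, e ∈ E') : Linked E' V :=
  fun A hA => h A fun e he => hA e (hE e he)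

theorem not_linked_nil {V : Set ℕ} (hV : V.Nontrivial) : ¬ Linked [] V := by
  obtain ⟨i, hi, j, hj, hij⟩ := hV
  intro h
  rcases h {i} (by simp) with h | h
  · exact hij (h hj).symm
  · exact Set.disjoint_left.1 h hi rfl

/-! ### Refuting linked sets

The following functions are written with recursors and continuations, so that the kernel evaluates
them quickly. -/

/-- Adds to the mask `A` the edges in `L` that meet it; these are moved to `inn`, the others to
`rest`. -/
noncomputable def sweep (k : ℕ → List (ℕ × ℕ) → List (ℕ × ℕ) → Bool → Bool)
    (L : List (ℕ × ℕ)) : ℕ → List (ℕ × ℕ) → List (ℕ × ℕ) → Bool → Bool :=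
  @List.rec _ (fun _ => ℕ → List (ℕ × ℕ) → List (ℕ × ℕ) → Bool → Bool)
    (fun A inn rest ch => k A inn rest ch)
    (fun e _ ih A inn rest ch =>
      @Bool.rec (fun _ => Bool)
        (@Nat.rec (fun _ => Bool) false
          (fun m _ => ih (Nat.succ m) (List.cons e inn) rest true) (Nat.lor A e.1))
        (ih A inn (List.cons e rest) ch) (Nat.beq (Nat.land e.1 A) 0)) L

/-- Specifications in continuation style have this shape: a final `true` comes from a call of `k`
whose arguments have the wanted properties. The flag records whether an edge was absorbed; if none
was, `A` did not change, so every edge in `rest` was tested against the final `A`. -/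
theorem sweep_spec {k : ℕ → List (ℕ × ℕ) → List (ℕ × ℕ) → Bool → Bool} (L : List (ℕ × ℕ)) :
    ∀ (A : ℕ) (inn rest : List (ℕ × ℕ)) (ch : Bool), sweep k L A inn rest ch = true →
      (∀ e ∈ inn, bits e.1 ⊆ bits A) →
      (ch = false → ∀ e ∈ rest, Disjoint (bits e.1) (bits A)) →
      ∃ A' inn' rest' ch', k A' inn' rest' ch' = true ∧
        (∀ e, e ∈ L ∨ e ∈ inn ∨ e ∈ rest → e ∈ inn' ∨ e ∈ rest') ∧
        (∀ e ∈ inn', bits e.1 ⊆ bits A') ∧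
        (ch' = false → ∀ e ∈ rest', Disjoint (bits e.1) (bits A')) := by
  induction L with
  | nil =>
    intro A inn rest ch h h₁ h₂
    exact ⟨A, inn, rest, ch, h, by simp, h₁, h₂⟩
  | cons e L ih =>
    intro A inn rest ch h h₁ h₂
    by_cases hd : Nat.land e.1 A = 0
    · have h' : sweep k L A inn (e :: rest) ch = true := by
        have hb : Nat.beq (Nat.land e.1 A) 0 = true := by rw [hd]; rfl
        simpa only [sweep, hb] using h
      obtain ⟨A', inn', rest', ch', g, g₁, g₂, g₃⟩ := ih _ _ _ _ h' h₁ (fun hc e' he' => by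
        rcases List.mem_cons.1 he' with rfl | he'
        · exact disjoint_bits.2 hd
        · exact h₂ hc e' he')
      refine ⟨A', inn', rest', ch', g, fun e' he' => g₁ e' ?_, g₂, g₃⟩
      simp only [List.mem_cons] at he' ⊢
      tauto
    · have h' : sweep k L (Nat.lor A e.1) (e :: inn) rest true = true := by
        have hb : Nat.beq (Nat.land e.1 A) 0 = false := by
          rw [Bool.eq_false_iff]; exact fun h => hd (Nat.eq_of_beq_eq_true h)
        apply forced_eq_true (k := fun m => sweep k L m (e :: inn) rest true)
        simpa only [sweep, hb] using h
      obtain ⟨A', inn', rest', ch', g, g₁, g₂, g₃⟩ := ih _ _ _ _ h' (fun e' he' => by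
        rw [bits_lor]
        rcases List.mem_cons.1 he' with rfl | he'
        · exact Set.subset_union_right
        · exact (h₁ e' he').trans Set.subset_union_left) (by simp)
      refine ⟨A', inn', rest', ch', g, fun e' he' => g₁ e' ?_, g₂, g₃⟩
      simp only [List.mem_cons] at he' ⊢
      tauto

/-- Keeps the edges whose label lies in the mask `A`. -/
noncomputable def sieveIn (A : ℕ) (k : List (ℕ × ℕ) → Bool) (L : List (ℕ × ℕ)) :
    List (ℕ × ℕ) → Bool :=
  @List.rec _ (fun _ => List (ℕ × ℕ) → Bool) (fun acc => k acc)
    (fun e _ ih acc => @Bool.rec (fun _ => Bool) (ih (List.cons e acc)) (ih acc)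
      (Nat.beq (Nat.land e.2 A) 0)) L

/-- Keeps the edges whose label does not lie in the mask `A`. -/
noncomputable def sieveOut (A : ℕ) (k : List (ℕ × ℕ) → Bool) (L : List (ℕ × ℕ)) :
    List (ℕ × ℕ) → Bool :=
  @List.rec _ (fun _ => List (ℕ × ℕ) → Bool) (fun acc => k acc)
    (fun e _ ih acc => @Bool.rec (fun _ => Bool) (ih acc) (ih (List.cons e acc))
      (Nat.beq (Nat.land e.2 A) 0)) L

theorem sieveIn_spec {A : ℕ} {k : List (ℕ × ℕ) → Bool} (L : List (ℕ × ℕ)) :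
    ∀ acc, sieveIn A k L acc = true → ∃ L', k L' = true ∧ acc ⊆ L' ∧
      ∀ e ∈ L, ¬ Disjoint (bits e.2) (bits A) → e ∈ L' := by
  induction L with
  | nil => exact fun acc h => ⟨acc, h, by simp, by simp⟩
  | cons e L ih =>
    intro acc h
    cases hb : Nat.beq (Nat.land e.2 A) 0 with
    | true =>
      have h' : sieveIn A k L acc = true := by simpa only [sieveIn, hb] using h
      obtain ⟨L', g, g₁, g₂⟩ := ih _ h'
      refine ⟨L', g, g₁, fun e' he' hd => ?_⟩
      rcases List.mem_cons.1 he' with rfl | he'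
      · exact absurd (disjoint_bits.2 (Nat.eq_of_beq_eq_true hb)) hd
      · exact g₂ e' he' hd
    | false =>
      have h' : sieveIn A k L (e :: acc) = true := by simpa only [sieveIn, hb] using h
      obtain ⟨L', g, g₁, g₂⟩ := ih _ h'
      refine ⟨L', g, fun x hx => g₁ (List.mem_cons_of_mem _ hx), fun e' he' hd => ?_⟩
      rcases List.mem_cons.1 he' with rfl | he'
      · exact g₁ List.mem_cons_self
      · exact g₂ e' he' hd

theorem sieveOut_spec {A : ℕ} {k : List (ℕ × ℕ) → Bool} (L : List (ℕ × ℕ)) :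
    ∀ acc, sieveOut A k L acc = true → ∃ L', k L' = true ∧ acc ⊆ L' ∧
      ∀ e ∈ L, Disjoint (bits e.2) (bits A) → e ∈ L' := by
  induction L with
  | nil => exact fun acc h => ⟨acc, h, by simp, by simp⟩
  | cons e L ih =>
    intro acc h
    cases hb : Nat.beq (Nat.land e.2 A) 0 with
    | true =>
      have h' : sieveOut A k L (e :: acc) = true := by simpa only [sieveOut, hb] using h
      obtain ⟨L', g, g₁, g₂⟩ := ih _ h'
      refine ⟨L', g, fun x hx => g₁ (List.mem_cons_of_mem _ hx), fun e' he' hd => ?_⟩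
      rcases List.mem_cons.1 he' with rfl | he'
      · exact g₁ List.mem_cons_self
      · exact g₂ e' he' hd
    | false =>
      have h' : sieveOut A k L acc = true := by simpa only [sieveOut, hb] using h
      obtain ⟨L', g, g₁, g₂⟩ := ih _ h'
      refine ⟨L', g, g₁, fun e' he' hd => ?_⟩
      rcases List.mem_cons.1 he' with rfl | he'
      · rw [disjoint_bits.1 hd] at hb
        exact absurd hb (by simp)
      · exact g₂ e' he' hd

/-- Starts to grow a component from the first edge. -/
noncomputable def growFirst (go : List (ℕ × ℕ) → ℕ → List (ℕ × ℕ) → Bool) (E : List (ℕ × ℕ)) :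
    Bool :=
  @List.rec _ (fun _ => Bool) true
    (fun e t _ => @Nat.rec (fun _ => Bool) false
      (fun m _ => go t (Nat.succ m) (List.cons e List.nil)) e.1) E

/-- Grows the component `A`; when it is complete, the edges inside and outside are treated
separately, without those whose label is on the wrong side. -/
noncomputable def grow (n : ℕ) : List (ℕ × ℕ) → ℕ → List (ℕ × ℕ) → Bool :=
  @Nat.rec (fun _ => List (ℕ × ℕ) → ℕ → List (ℕ × ℕ) → Bool) (fun _ _ _ => false)
    (fun _ ih E A inn => sweep (fun A inn rest ch =>
      @Bool.rec (fun _ => Bool)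
        (@Bool.rec (fun _ => Bool) false (sieveOut A (growFirst ih) rest [])
          (sieveIn A (growFirst ih) inn []))
        (ih rest A inn) ch) E A inn [] false) n

/-- A test which shows that a list of edges links no set with two elements. -/
noncomputable def refutes (n : ℕ) (E : List (ℕ × ℕ)) : Bool := growFirst (grow n) E

theorem not_linked_of_growFirst {go : List (ℕ × ℕ) → ℕ → List (ℕ × ℕ) → Bool}
    (hgo : ∀ (E : List (ℕ × ℕ)) (A : ℕ) (inn : List (ℕ × ℕ)), go E A inn = true →
      (∀ e ∈ inn, bits e.1 ⊆ bits A) → ∀ V : Set ℕ, V.Nontrivial → ¬ Linked (E ++ inn) V)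
    {E : List (ℕ × ℕ)} (h : growFirst go E = true) {V : Set ℕ} (hV : V.Nontrivial) :
    ¬ Linked E V := by
  cases E with
  | nil => exact not_linked_nil hV
  | cons e t =>
    have h' : go t e.1 [e] = true := forced_eq_true (k := fun m => go t m [e]) h
    refine fun hl => hgo _ _ _ h' (by simp) V hV (hl.mono fun e' he' => ?_)
    simp only [List.mem_append, List.mem_cons] at he' ⊢
    tauto

/-- Here `n` bounds the depth of nested passes. Running out gives `false`, which covers the graphs
that really do link a set. -/
theorem not_linked_of_grow (n : ℕ) : ∀ (E : List (ℕ × ℕ)) (A : ℕ) (inn : List (ℕ × ℕ)),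
    grow n E A inn = true → (∀ e ∈ inn, bits e.1 ⊆ bits A) → ∀ V : Set ℕ, V.Nontrivial →
      ¬ Linked (E ++ inn) V := by
  induction n with
  | zero => exact fun E A inn h => absurd h (by simp [grow])
  | succ n ih =>
    intro E A inn h h₁ V hV hl
    obtain ⟨A', inn', rest', ch', g, g₁, g₂, g₃⟩ := sweep_spec E A inn [] false h h₁ (by simp)
    have hmem : ∀ e ∈ E ++ inn, e ∈ inn' ∨ e ∈ rest' := fun e he => by
      rw [List.mem_append] at he
      exact g₁ e (by tauto)
    cases ch' with
    | true =>
      refine ih rest' A' inn' g g₂ V hV (hl.mono fun e he => ?_)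
      rw [List.mem_append]
      exact (hmem e he).symm
    | false =>
      -- The last pass absorbed nothing, so each edge lies inside `A'` or misses it, and `A'` is an
      -- admissible test set.
      have hsep := hl (bits A') fun e he _ _ _ =>
        (hmem e he).imp (g₂ e) (g₃ rfl e)
      replace g : @Bool.rec (fun _ => Bool) false (sieveOut A' (growFirst (grow n)) rest' [])
          (sieveIn A' (growFirst (grow n)) inn' []) = true := g
      cases hin : sieveIn A' (growFirst (grow n)) inn' [] with
      | false => rw [hin] at g; exact absurd g (by simp)
      | true =>
        rw [hin] at g
        rcases hsep with hs | hs
        · obtain ⟨L, k₁, -, k₂⟩ := sieveIn_spec _ _ hin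
          refine not_linked_of_growFirst ih k₁ hV ?_
          intro B hB
          -- Now `V` lies in `A'`. Cutting `B` down to `A'` makes the outer edges miss it; inner
          -- edges that were dropped have their label outside `V`.
          have key := hl (B ∩ bits A') ?_
          · rcases key with key | key
            · exact Or.inl (key.trans Set.inter_subset_left)
            · refine Or.inr (Set.disjoint_left.2 fun x hx hxB => ?_)
              exact Set.disjoint_left.1 key hx ⟨hxB, hs hx⟩
          · intro e he e₁ e₂ e₃
            rcases hmem e he with hm | hm
            · have hd : ¬ Disjoint (bits e.2) (bits A') := fun hd => by
                obtain ⟨x, hx⟩ := e₃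
                exact Set.disjoint_left.1 hd hx (hs (e₂ hx))
              rcases hB e (k₂ e hm hd) e₁ e₂ e₃ with hB | hB
              · exact Or.inl (Set.subset_inter hB (g₂ e hm))
              · exact Or.inr (hB.mono_right Set.inter_subset_left)
            · exact Or.inr ((g₃ rfl e hm).mono_right Set.inter_subset_right)
        · obtain ⟨L, k₁, -, k₂⟩ := sieveOut_spec _ _ g
          refine not_linked_of_growFirst ih k₁ hV ?_
          intro B hB
          -- Dually, `V` misses `A'`. Enlarging `B` by `A'` swallows the inner edges; outer edges
          -- that were dropped have their label in `A'`, hence outside `V`.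
          have key := hl (B ∪ bits A') ?_
          · rcases key with key | key
            · refine Or.inl fun x hx => (key hx).resolve_right fun hA => ?_
              exact Set.disjoint_left.1 hs hx hA
            · exact Or.inr (key.mono_right Set.subset_union_left)
          · intro e he e₁ e₂ e₃
            rcases hmem e he with hm | hm
            · exact Or.inl ((g₂ e hm).trans Set.subset_union_right)
            · rcases hB e (k₂ e hm (hs.mono_left e₂)) e₁ e₂ e₃ with hB | hB
              · exact Or.inl (hB.trans Set.subset_union_left)
              · exact Or.inr (Set.disjoint_union_right.2 ⟨hB, g₃ rfl e hm⟩)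

theorem not_linked_of_refutes {n : ℕ} {E : List (ℕ × ℕ)} (h : refutes n E = true) {V : Set ℕ}
    (hV : V.Nontrivial) : ¬ Linked E V :=
  not_linked_of_growFirst (not_linked_of_grow n) h hV

/-! ### Searching through the subsets of `ZMod p` -/

/-- The edge of a palette graph with ends `b₁`, `b₂` and label `l`, as a pair of masks. -/
def maskEdge {p : ℕ} (b₁ b₂ l : ZMod p) : ℕ × ℕ :=
  (Nat.lor (Nat.shiftLeft 1 b₁.val) (Nat.shiftLeft 1 b₂.val), Nat.shiftLeft 1 l.val)

theorem maskEdge_comm {p : ℕ} (b₁ b₂ l : ZMod p) : maskEdge b₁ b₂ l = maskEdge b₂ b₁ l := by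
  have : Nat.lor (Nat.shiftLeft 1 b₁.val) (Nat.shiftLeft 1 b₂.val) =
      Nat.lor (Nat.shiftLeft 1 b₂.val) (Nat.shiftLeft 1 b₁.val) := Nat.lor_comm _ _
  rw [maskEdge, this, maskEdge]

/-- The edges with `a₁ = z`, `a₃ = a`, `a₂` in `T` and `a₄` in `M`, where `l` is `z + a + p`. -/
noncomputable def addEdgesAt (p z a l M : ℕ) (k : List (ℕ × ℕ) → Bool) (T : List ℕ) :
    List (ℕ × ℕ) → Bool :=
  @List.rec _ (fun _ => List (ℕ × ℕ) → Bool) k (fun b _ ih acc =>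
    (fun c : ℕ =>
      @Bool.rec (fun _ => Bool)
        (@Bool.rec (fun _ => Bool)
          (@Nat.rec (fun _ => Bool) false
            (fun m _ => @Nat.rec (fun _ => Bool) false
              (fun l _ => ih (List.cons (Nat.succ m, Nat.succ l) acc))
              (Nat.shiftLeft 1 (Nat.mod l p)))
            (Nat.lor (Nat.shiftLeft 1 (Nat.mod (Nat.add z b) p))
              (Nat.shiftLeft 1 (Nat.mod (Nat.add a c) p))))
          (ih acc) (Nat.beq (Nat.mod (Nat.add z b) p) (Nat.mod (Nat.add a c) p)))
        (ih acc) (Nat.beq (Nat.land (Nat.shiftLeft 1 c) M) 0)) (Nat.mod (Nat.sub l b) p)) T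

/-- The edges with `a₁ = z`, `a₃` in `T`, `a₂` in `T'` and `a₄` in `M`. -/
noncomputable def addEdges (p z M : ℕ) (T' : List ℕ) (k : List (ℕ × ℕ) → Bool) (T : List ℕ) :
    List (ℕ × ℕ) → Bool :=
  @List.rec _ (fun _ => List (ℕ × ℕ) → Bool) k (fun a _ ih acc =>
    @Nat.rec (fun _ => Bool) false
      (fun l _ => addEdgesAt p z a (Nat.succ l) M ih T' acc) (Nat.add (Nat.add z a) p)) T

theorem mem_bits_iff_not_disjoint {c M : ℕ} :
    c ∈ bits M ↔ Nat.beq (Nat.land (Nat.shiftLeft 1 c) M) 0 = false := by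
  rw [Bool.eq_false_iff, ne_eq, Nat.beq_eq, ← disjoint_bits, bits_shiftLeft,
    Set.disjoint_singleton_left, not_not]

/-- The summand `p` keeps the natural subtraction from truncating. -/
theorem val_add_sub {p : ℕ} [NeZero p] (z a b : ZMod p) :
    Nat.mod (Nat.sub (z.val + a.val + p) b.val) p = (z + a - b).val := by
  have hb := b.val_lt.le
  change (z.val + a.val + p - b.val) % p = _
  rw [← ZMod.val_natCast, Nat.cast_sub (by lia)]
  simp

theorem val_add_eq_mod {p : ℕ} [NeZero p] (a b : ZMod p) :
    Nat.mod (Nat.add a.val b.val) p = (a + b).val := (ZMod.val_add a b).symm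

theorem addEdgesAt_cons {p : ℕ} [NeZero p] {z a b : ZMod p} {M : ℕ} {k : List (ℕ × ℕ) → Bool}
    {T : List ℕ} {acc : List (ℕ × ℕ)}
    (h : addEdgesAt p z.val a.val (z.val + a.val + p) M k (b.val :: T) acc = true) :
    ∃ acc', acc ⊆ acc' ∧ addEdgesAt p z.val a.val (z.val + a.val + p) M k T acc' = true ∧
      ((z + a - b).val ∈ bits M → z + b ≠ a + (z + a - b) →
        maskEdge (z + b) (a + (z + a - b)) (z + a) ∈ acc') := by
  have hl : Nat.mod (z.val + a.val + p) p = (z + a).val := by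
    change (z.val + a.val + p) % p = _
    rw [Nat.add_mod_right, ZMod.val_add]
  obtain ⟨R, hR⟩ : ∃ R, R = addEdgesAt p z.val a.val (z.val + a.val + p) M k T := ⟨_, rfl⟩
  rw [← hR]
  replace h : @Bool.rec (fun _ => Bool)
        (@Bool.rec (fun _ => Bool)
          (@Nat.rec (fun _ => Bool) false
            (fun m _ => @Nat.rec (fun _ => Bool) false
              (fun l _ => addEdgesAt p z.val a.val (z.val + a.val + p) M k T
                (List.cons (Nat.succ m, Nat.succ l) acc))
              (Nat.shiftLeft 1 (Nat.mod (z.val + a.val + p) p)))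
            (Nat.lor (Nat.shiftLeft 1 (Nat.mod (Nat.add z.val b.val) p))
              (Nat.shiftLeft 1 (Nat.mod (Nat.add a.val
                (Nat.mod (Nat.sub (z.val + a.val + p) b.val) p)) p))))
          (addEdgesAt p z.val a.val (z.val + a.val + p) M k T acc)
          (Nat.beq (Nat.mod (Nat.add z.val b.val) p) (Nat.mod (Nat.add a.val
            (Nat.mod (Nat.sub (z.val + a.val + p) b.val) p)) p)))
        (addEdgesAt p z.val a.val (z.val + a.val + p) M k T acc)
        (Nat.beq (Nat.land (Nat.shiftLeft 1
          (Nat.mod (Nat.sub (z.val + a.val + p) b.val) p)) M) 0) = true := h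
  rw [← hR, hl, val_add_sub, val_add_eq_mod, val_add_eq_mod] at h
  cases h₁ : Nat.beq (Nat.land (Nat.shiftLeft 1 (z + a - b).val) M) 0 with
  | true =>
    rw [h₁] at h
    refine ⟨acc, List.Subset.refl _, h, fun h₂ => ?_⟩
    rw [mem_bits_iff_not_disjoint, h₁] at h₂
    exact absurd h₂ (by simp)
  | false =>
    rw [h₁] at h
    cases h₂ : Nat.beq (z + b).val (a + (z + a - b)).val with
    | true =>
      rw [h₂] at h
      exact ⟨acc, List.Subset.refl _, h, fun _ h₃ =>
        absurd (ZMod.val_injective p (Nat.eq_of_beq_eq_true h₂)) h₃⟩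
    | false =>
      rw [h₂] at h
      exact ⟨maskEdge (z + b) (a + (z + a - b)) (z + a) :: acc, List.subset_cons_self _ _,
        forced_eq_true (k := fun l => R ((_, l) :: acc)) (forced_eq_true
          (k := fun m => @Nat.rec (fun _ => Bool) false
            (fun l _ => R (List.cons (m, Nat.succ l) acc)) _) h), fun _ _ => List.mem_cons_self⟩

/-- The fourth element is forced to be `z + a - b`, so a loop over `b` with a mask test finds every
edge. -/
theorem addEdgesAt_spec {p : ℕ} [NeZero p] {z a : ZMod p} {M : ℕ} {k : List (ℕ × ℕ) → Bool}
    (T : List ℕ) (hT : ∀ x ∈ T, x < p) :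
    ∀ acc, addEdgesAt p z.val a.val (z.val + a.val + p) M k T acc = true →
      ∃ E, k E = true ∧ acc ⊆ E ∧ ∀ b c : ZMod p, b.val ∈ T → c.val ∈ bits M → z + a = b + c →
        z + b ≠ a + c → maskEdge (z + b) (a + c) (z + a) ∈ E := by
  induction T with
  | nil => exact fun acc h => ⟨acc, h, List.Subset.refl _, by simp⟩
  | cons x T ih =>
    intro acc h
    obtain ⟨x, rfl⟩ : ∃ y : ZMod p, y.val = x := ⟨x, ZMod.val_cast_of_lt (hT x List.mem_cons_self)⟩
    obtain ⟨acc', hacc, h', hx⟩ := addEdgesAt_cons h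
    obtain ⟨E, g, g₁, g₂⟩ := ih (fun y hy => hT y (List.mem_cons_of_mem _ hy)) _ h'
    refine ⟨E, g, List.Subset.trans hacc g₁, fun b c hb hc hs hne => ?_⟩
    rcases List.mem_cons.1 hb with hb | hb
    · obtain rfl := ZMod.val_injective p hb
      obtain rfl : z + a - b = c := by rw [hs, add_sub_cancel_left]
      exact g₁ (hx hc hne)
    · exact g₂ b c hb hc hs hne

theorem addEdges_spec {p : ℕ} [NeZero p] {z : ZMod p} {M : ℕ} {k : List (ℕ × ℕ) → Bool}
    (T T' : List ℕ) (hT : ∀ x ∈ T, x < p) (hT' : ∀ x ∈ T', x < p) :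
    ∀ acc, addEdges p z.val M T' k T acc = true →
      ∃ E, k E = true ∧ acc ⊆ E ∧ ∀ a b c : ZMod p, a.val ∈ T → b.val ∈ T' → c.val ∈ bits M →
        z + a = b + c → z + b ≠ a + c → maskEdge (z + b) (a + c) (z + a) ∈ E := by
  induction T with
  | nil => exact fun acc h => ⟨acc, h, List.Subset.refl _, by simp⟩
  | cons x T ih =>
    intro acc h
    obtain ⟨x, rfl⟩ : ∃ y : ZMod p, y.val = x := ⟨x, ZMod.val_cast_of_lt (hT x List.mem_cons_self)⟩
    have h' : addEdgesAt p z.val x.val (z.val + x.val + p) M (addEdges p z.val M T' k T) T' acc =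
        true := forced_eq_true (k := fun l => addEdgesAt p z.val x.val l M
          (addEdges p z.val M T' k T) T' acc) h
    obtain ⟨acc', h₁, hacc, hx⟩ := addEdgesAt_spec T' hT' acc h'
    obtain ⟨E, g, g₁, g₂⟩ := ih (fun y hy => hT y (List.mem_cons_of_mem _ hy)) _ h₁
    refine ⟨E, g, List.Subset.trans hacc g₁, fun a b c ha hb hc hs hne => ?_⟩
    rcases List.mem_cons.1 ha with ha | ha
    · obtain rfl := ZMod.val_injective p ha
      exact g₁ (hx b c hb hc hs hne)
    · exact g₂ a b c ha hb hc hs hne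

/-! ### Linked palettes and exhaustive search -/

/-- A set contains an arithmetic progression with three distinct terms. -/
def HasThreeAP {p : ℕ} (S : Set (ZMod p)) : Prop :=
  ∃ a ∈ S, ∃ b ∈ S, ∃ c ∈ S, a ≠ b ∧ a + c = b + b

/-- The palette graph of `S` has a nontrivial set of vertices that cannot be separated by a set that
separates the ends of none of the edges with ends and label in it. -/
def HasLinkedPalette {p : ℕ} (S : Set (ZMod p)) : Prop :=
  ∃ V : Set (ZMod p), V.Nontrivial ∧ ∀ A : Set (ZMod p),
    (∀ a₁ ∈ S, ∀ a₂ ∈ S, ∀ a₃ ∈ S, ∀ a₄ ∈ S, a₁ + a₃ = a₂ + a₄ → a₁ + a₂ ∈ V → a₃ + a₄ ∈ V →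
      a₁ + a₃ ∈ V → (a₁ + a₂ ∈ A ↔ a₃ + a₄ ∈ A)) → V ⊆ A ∨ Disjoint V A

/-- The mask `M` describes the set `S`. -/
def IsMask {p : ℕ} (M : ℕ) (S : Set (ZMod p)) : Prop := ∀ y : ZMod p, y.val ∈ bits M ↔ y ∈ S

/-- Data accompanying a subset `S` of `ZMod p` in the search for supersets violating `Q`: the list
`T` of its elements, its mask `M`, the edges `E` of its palette graph, and a mask `F` of elements
that need not be added to it. -/
structure SearchState {p : ℕ} (Q : Finset (ZMod p) → Prop) (S : Finset (ZMod p)) (T : List ℕ)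
    (M : ℕ) (E : List (ℕ × ℕ)) (F : ℕ) : Prop where
  isMask : IsMask M (S : Set (ZMod p))
  mem_list : ∀ y : ZMod p, y.val ∈ T ↔ y ∈ S
  lt : ∀ x ∈ T, x < p
  edges : ∀ a₁ ∈ S, ∀ a₂ ∈ S, ∀ a₃ ∈ S, ∀ a₄ ∈ S, a₁ + a₃ = a₂ + a₄ → a₁ + a₂ ≠ a₃ + a₄ →
    maskEdge (a₁ + a₂) (a₃ + a₄) (a₁ + a₃) ∈ E
  forbidden : ∀ y : ZMod p, y.val ∈ bits F → ∀ S', insert y S ⊆ S' → Q S'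

theorem SearchState.empty {p : ℕ} (Q : Finset (ZMod p) → Prop) :
    SearchState Q ∅ [] 0 [] 0 where
  isMask y := by simp [bits_zero]
  mem_list y := by simp
  lt := by simp
  edges := by simp
  forbidden y hy := by simp [bits_zero] at hy

/-- Adds to `F` the elements that form arithmetic progressions with `x` and an element of `T`. -/
noncomputable def forbid (p x : ℕ) (k : ℕ → Bool) (T : List ℕ) : ℕ → Bool :=
  @List.rec _ (fun _ => ℕ → Bool) k (fun a _ ih F =>
    @Nat.rec (fun _ => Bool) false (fun F' _ => ih (Nat.succ F'))
      (Nat.lor F (Nat.lor (Nat.shiftLeft 1 (Nat.mod (Nat.sub (Nat.add (Nat.add x x) p) a) p))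
        (Nat.lor (Nat.shiftLeft 1 (Nat.mod (Nat.sub (Nat.add (Nat.add a a) p) x) p))
          (Nat.shiftLeft 1
            (Nat.mod (Nat.mul (Nat.add x a) (Nat.div (Nat.succ p) 2)) p)))))) T

theorem forbid_spec {p : ℕ} [NeZero p] (hodd : Odd p) {x : ZMod p} {k : ℕ → Bool} (T : List ℕ)
    (hT : ∀ a ∈ T, a < p) : ∀ F, forbid p x.val k T F = true → ∃ F', k F' = true ∧
      ∀ y : ZMod p, y.val ∈ bits F' → y.val ∈ bits F ∨
        ∃ a : ZMod p, a.val ∈ T ∧ (a + y = x + x ∨ x + y = a + a ∨ x + a = y + y) := by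
  induction T with
  | nil => exact fun F h => ⟨F, h, fun y hy => Or.inl hy⟩
  | cons a T ih =>
    intro F h
    obtain ⟨a, rfl⟩ : ∃ y : ZMod p, y.val = a := ⟨a, ZMod.val_cast_of_lt (hT a List.mem_cons_self)⟩
    obtain ⟨F', g, hF'⟩ := ih (fun y hy => hT y (List.mem_cons_of_mem _ hy)) _
      (forced_eq_true (k := fun F' => forbid p x.val k T F') h)
    refine ⟨F', g, fun y hy => ?_⟩
    rcases hF' y hy with hy | ⟨b, hb, hy⟩
    · have hhalf : Nat.mod (Nat.mul (Nat.add x.val a.val) (Nat.div (Nat.succ p) 2)) p =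
          ((x + a) * (((p + 1) / 2 : ℕ) : ZMod p)).val := by
        change (x.val + a.val) * ((p + 1) / 2) % p = _
        rw [← ZMod.val_natCast]
        simp
      -- For odd `p` the number `(p + 1) / 2` is the inverse of 2; it produces the midpoint of `x`
      -- and `a`.
      have htwo : (((p + 1) / 2 : ℕ) : ZMod p) + (((p + 1) / 2 : ℕ) : ZMod p) = 1 := by
        obtain ⟨m, rfl⟩ := hodd
        have : (2 * m + 1 + 1) / 2 + (2 * m + 1 + 1) / 2 = (2 * m + 1) + 1 := by lia
        rw [← Nat.cast_add, this, Nat.cast_add, ZMod.natCast_self]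
        simp
      rw [hhalf, bits_lor, bits_lor, bits_lor, bits_shiftLeft, bits_shiftLeft, bits_shiftLeft] at hy
      rcases hy with hy | hy | hy | hy
      · exact Or.inl hy
      · refine Or.inr ⟨a, List.mem_cons_self, Or.inl ?_⟩
        have := (val_add_sub x x a).symm.trans hy.symm
        rw [← ZMod.val_injective p this]
        ring
      · refine Or.inr ⟨a, List.mem_cons_self, Or.inr (Or.inl ?_)⟩
        have := (val_add_sub a a x).symm.trans hy.symm
        rw [← ZMod.val_injective p this]
        ring
      · refine Or.inr ⟨a, List.mem_cons_self, Or.inr (Or.inr ?_)⟩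
        rw [ZMod.val_injective p hy, ← mul_add, htwo, mul_one]
    · exact Or.inr ⟨b, List.mem_cons_of_mem _ hb, hy⟩

/-- Adds the element `x` to the set described by `T`, `M`, `E`, `F`; if `noAP` holds, only sets
without arithmetic progressions are of interest. -/
noncomputable def extend (p : ℕ) (noAP : Bool) (x : ℕ)
    (k : List ℕ → ℕ → List (ℕ × ℕ) → ℕ → Bool) (T : List ℕ) (M : ℕ) (E : List (ℕ × ℕ)) (F : ℕ) :
    Bool :=
  @Nat.rec (fun _ => Bool) false (fun M _ =>
    addEdges p x (Nat.succ M) (List.cons x T) (fun E =>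
      @Bool.rec (fun _ => Bool) (k (List.cons x T) (Nat.succ M) E F)
        (forbid p x (fun F => k (List.cons x T) (Nat.succ M) E F) T F) noAP) (List.cons x T) E)
    (Nat.lor M (Nat.shiftLeft 1 x))

theorem extend_spec {p : ℕ} [NeZero p] (hodd : Odd p) {noAP : Bool} {Q : Finset (ZMod p) → Prop}
    (hQ : noAP = true → ∀ S : Finset (ZMod p), HasThreeAP (S : Set (ZMod p)) → Q S)
    {x : ZMod p} {k : List ℕ → ℕ → List (ℕ × ℕ) → ℕ → Bool} {S : Finset (ZMod p)} {T : List ℕ}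
    {M : ℕ} {E : List (ℕ × ℕ)} {F : ℕ} (hS : SearchState Q S T M E F) (hx : x ∉ S)
    (h : extend p noAP x.val k T M E F = true) :
    ∃ T' M' E' F', k T' M' E' F' = true ∧ SearchState Q (insert x S) T' M' E' F' := by
  have hlt : ∀ a ∈ x.val :: T, a < p := by
    intro a ha
    rcases List.mem_cons.1 ha with rfl | ha
    · exact x.val_lt
    · exact hS.lt a ha
  have hmem : ∀ y : ZMod p, y.val ∈ x.val :: T ↔ y ∈ insert x S := fun y => by
    rw [List.mem_cons, Finset.mem_insert, hS.mem_list, (ZMod.val_injective p).eq_iff]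
  have hmask : IsMask (Nat.lor M (Nat.shiftLeft 1 x.val)) ((insert x S : Finset (ZMod p)) :
      Set (ZMod p)) := fun y => by
    rw [bits_lor, bits_shiftLeft, Set.mem_union, hS.isMask, Set.mem_singleton_iff,
      (ZMod.val_injective p).eq_iff, Finset.coe_insert, Set.mem_insert_iff, or_comm]
  have h₁ : addEdges p x.val (Nat.lor M (Nat.shiftLeft 1 x.val)) (x.val :: T) (fun E =>
      @Bool.rec (fun _ => Bool) (k (x.val :: T) (Nat.lor M (Nat.shiftLeft 1 x.val)) E F)
        (forbid p x.val (fun F => k (x.val :: T) (Nat.lor M (Nat.shiftLeft 1 x.val)) E F) T F) noAP)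
      (x.val :: T) E = true :=
    forced_eq_true (k := fun M => addEdges p x.val M (x.val :: T) (fun E =>
      @Bool.rec (fun _ => Bool) (k (x.val :: T) M E F)
        (forbid p x.val (fun F => k (x.val :: T) M E F) T F) noAP) (x.val :: T) E) h
  obtain ⟨E', g, hE, hE'⟩ := addEdges_spec _ _ hlt hlt _ h₁
  have hedges : ∀ a₁ ∈ insert x S, ∀ a₂ ∈ insert x S, ∀ a₃ ∈ insert x S, ∀ a₄ ∈ insert x S,
      a₁ + a₃ = a₂ + a₄ → a₁ + a₂ ≠ a₃ + a₄ → maskEdge (a₁ + a₂) (a₃ + a₄) (a₁ + a₃) ∈ E' := by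
    -- New edges involve `x`. Swapping `(a₁, a₃)` with `(a₂, a₄)`, or `(a₁, a₂)` with `(a₃, a₄)`,
    -- preserves the edge and its label, and these swaps move any position to the first, so `a₁ = x`
    -- suffices.
    have key : ∀ a₂ ∈ insert x S, ∀ a₃ ∈ insert x S, ∀ a₄ ∈ insert x S, x + a₃ = a₂ + a₄ →
        x + a₂ ≠ a₃ + a₄ → maskEdge (x + a₂) (a₃ + a₄) (x + a₃) ∈ E' :=
      fun a₂ h₂ a₃ h₃ a₄ h₄ => hE' a₃ a₂ a₄ ((hmem a₃).2 h₃) ((hmem a₂).2 h₂) ((hmask a₄).2 h₄)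
    intro a₁ h₁ a₂ h₂ a₃ h₃ a₄ h₄ hs hne
    by_cases e₁ : a₁ = x
    · subst e₁; exact key a₂ h₂ a₃ h₃ a₄ h₄ hs hne
    by_cases e₂ : a₂ = x
    · subst e₂
      rw [hs, add_comm a₁, add_comm a₃]
      exact key a₁ h₁ a₄ h₄ a₃ h₃ hs.symm (by rwa [add_comm a₁, add_comm a₃] at hne)
    by_cases e₃ : a₃ = x
    · subst e₃
      rw [maskEdge_comm, add_comm a₁ a₃]
      exact key a₄ h₄ a₁ h₁ a₂ h₂ (by rw [add_comm, hs, add_comm]) hne.symm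
    by_cases e₄ : a₄ = x
    · subst e₄
      rw [maskEdge_comm, hs, add_comm a₃, add_comm a₁, add_comm a₂ a₄]
      exact key a₃ h₃ a₂ h₂ a₁ h₁ (by rw [add_comm, ← hs, add_comm])
        (by rw [add_comm a₄, add_comm a₂]; exact hne.symm)
    · refine hE (hS.edges _ ?_ _ ?_ _ ?_ _ ?_ hs hne)
      · exact (Finset.mem_insert.1 h₁).resolve_left e₁
      · exact (Finset.mem_insert.1 h₂).resolve_left e₂
      · exact (Finset.mem_insert.1 h₃).resolve_left e₃
      · exact (Finset.mem_insert.1 h₄).resolve_left e₄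
  have hforb : ∀ y : ZMod p, y.val ∈ bits F → ∀ S', insert y (insert x S) ⊆ S' → Q S' :=
    fun y hy S' hS' => hS.forbidden y hy S'
      ((Finset.insert_subset_insert y (Finset.subset_insert x S)).trans hS')
  cases noAP with
  | false => exact ⟨_, _, E', F, g, hmask, hmem, hlt, hedges, hforb⟩
  | true =>
    obtain ⟨F', k₁, k₂⟩ := forbid_spec hodd T hS.lt F g
    refine ⟨_, _, E', F', k₁, hmask, hmem, hlt, hedges, fun y hy S' hS' => ?_⟩
    rcases k₂ y hy with hy | ⟨a, ha, hy⟩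
    · exact hforb y hy S' hS'
    · have haS := (hS.mem_list a).1 ha
      have hax : a ≠ x := fun e => hx (e ▸ haS)
      have ha' : a ∈ S' := hS' (by simp [haS])
      have hx' : x ∈ S' := hS' (by simp)
      have hy' : y ∈ S' := hS' (by simp)
      refine hQ rfl S' ?_
      rcases hy with hy | hy | hy
      · exact ⟨a, ha', x, hx', y, hy', hax, hy⟩
      -- In this and the previous case `y` is an outer term of the progression; in the next it is
      -- the middle one.
      · exact ⟨x, hx', a, ha', y, hy', hax.symm, hy⟩
      · refine ⟨x, hx', y, hy', a, ha', ?_, hy⟩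
        rintro rfl
        exact hax (add_left_cancel hy)

/-- Adds `k` elements less than `x` in all possible ways. -/
noncomputable def search (p : ℕ) (noAP : Bool) (leaf : ℕ → List (ℕ × ℕ) → Bool) (x : ℕ) :
    ℕ → List ℕ → ℕ → List (ℕ × ℕ) → ℕ → Bool :=
  @Nat.rec (fun _ => ℕ → List ℕ → ℕ → List (ℕ × ℕ) → ℕ → Bool)
    (fun k _ M E _ => @Nat.rec (fun _ => Bool) (leaf M E) (fun _ _ => true) k)
    (fun x ih k T M E F => @Nat.rec (fun _ => Bool) (leaf M E)
      (fun k' _ => @Bool.rec (fun _ => Bool) false (ih (Nat.succ k') T M E F)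
        (@Bool.rec (fun _ => Bool) true (extend p noAP x (ih k') T M E F)
          (Nat.beq (Nat.land (Nat.shiftLeft 1 x) (Nat.lor M F)) 0))) k) x

/-- Elements are decided in decreasing order, so whatever is still to be added lies below `x`. An
`x` in `M` or `F` needs no adding branch: it is already in `S`, or every superset containing it
satisfies `Q`. -/
theorem search_spec {p : ℕ} [NeZero p] (hodd : Odd p) {noAP : Bool} {Q : Finset (ZMod p) → Prop}
    (hQ : noAP = true → ∀ S : Finset (ZMod p), HasThreeAP (S : Set (ZMod p)) → Q S)
    {leaf : ℕ → List (ℕ × ℕ) → Bool}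
    (hleaf : ∀ S T M E F, SearchState Q S T M E F → leaf M E = true → Q S) (x : ℕ) :
    x ≤ p → ∀ k S T M E F, search p noAP leaf x k T M E F = true → SearchState Q S T M E F →
      ∀ S', S ⊆ S' → S'.card = S.card + k → (∀ y ∈ S', y ∉ S → y.val < x) → Q S' := by
  have zero : ∀ S T M E F, leaf M E = true → SearchState Q S T M E F →
      ∀ S', S ⊆ S' → S'.card = S.card + 0 → Q S' := by
    intro S T M E F h hS S' hSS' hc
    rw [← Finset.eq_of_subset_of_card_le hSS' hc.le]
    exact hleaf S T M E F hS h
  induction x with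
  | zero =>
    intro _ k S T M E F h hS S' hSS' hc hlt
    cases k with
    | zero => exact zero S T M E F h hS S' hSS' hc
    | succ k =>
      have : S' ⊆ S := fun y hy => by_contra fun hyS => absurd (hlt y hy hyS) (by lia)
      have := Finset.card_le_card this
      lia
  | succ x ih =>
    intro hx k S T M E F h hS S' hSS' hc hlt
    cases k with
    | zero => exact zero S T M E F h hS S' hSS' hc
    | succ k =>
      obtain ⟨x, rfl⟩ : ∃ y : ZMod p, y.val = x := ⟨x, ZMod.val_cast_of_lt hx⟩
      replace h : @Bool.rec (fun _ => Bool) false (search p noAP leaf x.val (k + 1) T M E F)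
        (@Bool.rec (fun _ => Bool) true (extend p noAP x.val (search p noAP leaf x.val k) T M E F)
          (Nat.beq (Nat.land (Nat.shiftLeft 1 x.val) (Nat.lor M F)) 0)) = true := h
      have h₁ : @Bool.rec (fun _ => Bool) true
          (extend p noAP x.val (search p noAP leaf x.val k) T M E F)
          (Nat.beq (Nat.land (Nat.shiftLeft 1 x.val) (Nat.lor M F)) 0) = true := by
        by_contra hn
        rw [Bool.not_eq_true] at hn
        rw [hn] at h
        exact absurd h (by simp)
      rw [h₁] at h
      by_cases hxS : x ∈ S' ∧ x ∉ S
      · cases hb : Nat.beq (Nat.land (Nat.shiftLeft 1 x.val) (Nat.lor M F)) 0 with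
        | false =>
          rw [← mem_bits_iff_not_disjoint, bits_lor] at hb
          rcases hb with hb | hb
          · exact absurd ((hS.isMask x).1 hb) hxS.2
          · exact hS.forbidden x hb S' (Finset.insert_subset hxS.1 hSS')
        | true =>
          rw [hb] at h₁
          obtain ⟨T', M', E', F', g, hS₁⟩ := extend_spec hodd hQ hS hxS.2 h₁
          refine ih (by lia) k _ T' M' E' F' g hS₁ S' (Finset.insert_subset hxS.1 hSS') ?_ ?_
          · rw [Finset.card_insert_of_notMem hxS.2]; lia
          · intro y hy hyS
            rw [Finset.mem_insert, not_or] at hyS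
            have h₂ := hlt y hy hyS.2
            have h₃ := fun e => hyS.1 (ZMod.val_injective p e)
            lia
      · refine ih (by lia) (k + 1) S T M E F h hS S' hSS' hc fun y hy hyS => ?_
        have h₂ := hlt y hy hyS
        have h₃ : y.val ≠ x.val := fun e => hxS (ZMod.val_injective p e ▸ ⟨hy, hyS⟩)
        lia

/-! ### Affine images of given sets -/

/-- The mask of the image of `T` under `a ↦ s * a + t`. -/
noncomputable def imageMask (p s t : ℕ) (k : ℕ → Bool) (T : List ℕ) : ℕ → Bool :=
  @List.rec _ (fun _ => ℕ → Bool) k (fun a _ ih m =>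
    @Nat.rec (fun _ => Bool) false (fun m' _ => ih (Nat.succ m'))
      (Nat.lor m (Nat.shiftLeft 1 (Nat.mod (Nat.add (Nat.mul s a) t) p)))) T

/-- The masks containing `7` of the images of `T` under the maps `a ↦ s * a + j` with `j < t`. -/
noncomputable def translates (p s : ℕ) (T : List ℕ) (k : List ℕ → Bool) (t : ℕ) : List ℕ → Bool :=
  @Nat.rec (fun _ => List ℕ → Bool) k (fun t ih acc => imageMask p s t (fun m =>
    @Bool.rec (fun _ => Bool) (ih acc) (ih (List.cons m acc)) (Nat.beq (Nat.land m 7) 7)) T 0) t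

/-- The masks containing `7` of the images of `T` under the maps `a ↦ i * a + j` with
`0 < i ≤ s`. -/
noncomputable def affineImages (p : ℕ) (T : List ℕ) (k : List ℕ → Bool) (s : ℕ) :
    List ℕ → Bool :=
  @Nat.rec (fun _ => List ℕ → Bool) k (fun s ih acc => translates p (Nat.succ s) T ih p acc) s

/-- The masks containing `7` of the affine images of the members of `L`. -/
noncomputable def allAffineImages (p : ℕ) (k : List ℕ → Bool) (L : List (List ℕ)) :
    List ℕ → Bool :=
  @List.rec _ (fun _ => List ℕ → Bool) k
    (fun T _ ih acc => affineImages p T ih (Nat.pred p) acc) L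

theorem imageMask_spec {p s t : ℕ} {k : ℕ → Bool} (T : List ℕ) :
    ∀ m, imageMask p s t k T m = true →
    ∃ m', k m' = true ∧ bits m' = bits m ∪ {i | ∃ a ∈ T, (s * a + t) % p = i} := by
  induction T with
  | nil => exact fun m h => ⟨m, h, by simp⟩
  | cons a T ih =>
    intro m h
    obtain ⟨m', g, hm'⟩ := ih _ (forced_eq_true (k := fun m' => imageMask p s t k T m') h)
    refine ⟨m', g, ?_⟩
    rw [hm', bits_lor, bits_shiftLeft, Set.union_assoc]
    congr 1
    ext i
    change (i = (s * a + t) % p ∨ _) ↔ _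
    simp [eq_comm]

/-- The mask 7 is `{0, 1, 2}`, contained in every set that will be looked up. Discarding other
images is sound, as the claim concerns only what is in the table. -/
theorem translates_spec {p s : ℕ} {T : List ℕ} {k : List ℕ → Bool} (t : ℕ) :
    ∀ acc, translates p s T k t acc = true → ∃ tab, k tab = true ∧ ∀ m ∈ tab, m ∈ acc ∨
      ∃ j, bits m = {i | ∃ a ∈ T, (s * a + j) % p = i} := by
  induction t with
  | zero => exact fun acc h => ⟨acc, h, fun m hm => Or.inl hm⟩
  | succ t ih =>
    intro acc h
    obtain ⟨m, g, hm⟩ := imageMask_spec T _ h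
    rw [bits_zero, Set.empty_union] at hm
    cases hb : Nat.beq (Nat.land m 7) 7 with
    | false =>
      rw [hb] at g
      exact ih acc g
    | true =>
      rw [hb] at g
      obtain ⟨tab, g, h₁⟩ := ih _ g
      refine ⟨tab, g, fun m' hm' => ?_⟩
      rcases h₁ m' hm' with h₂ | h₂
      · rcases List.mem_cons.1 h₂ with rfl | h₂
        · exact Or.inr ⟨t, hm⟩
        · exact Or.inl h₂
      · exact Or.inr h₂

theorem affineImages_spec {p : ℕ} {T : List ℕ} {k : List ℕ → Bool} (s : ℕ) (hs : s < p) :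
    ∀ acc, affineImages p T k s acc = true → ∃ tab, k tab = true ∧ ∀ m ∈ tab, m ∈ acc ∨
      ∃ i j, 0 < i ∧ i < p ∧ bits m = {x | ∃ a ∈ T, (i * a + j) % p = x} := by
  induction s with
  | zero => exact fun acc h => ⟨acc, h, fun m hm => Or.inl hm⟩
  | succ s ih =>
    intro acc h
    obtain ⟨acc', g, h₁⟩ := translates_spec _ _ h
    obtain ⟨tab, g, h₂⟩ := ih (by lia) _ g
    refine ⟨tab, g, fun m hm => ?_⟩
    rcases h₂ m hm with hm | hm
    · exact (h₁ m hm).imp_right fun ⟨j, hj⟩ => ⟨s + 1, j, s.succ_pos, hs, hj⟩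
    · exact Or.inr hm

theorem allAffineImages_spec {p : ℕ} (hp : 0 < p) {k : List ℕ → Bool} (L : List (List ℕ)) :
    ∀ acc, allAffineImages p k L acc = true → ∃ tab, k tab = true ∧ ∀ m ∈ tab, m ∈ acc ∨
      ∃ T ∈ L, ∃ i j, 0 < i ∧ i < p ∧ bits m = {x | ∃ a ∈ T, (i * a + j) % p = x} := by
  induction L with
  | nil => exact fun acc h => ⟨acc, h, fun m hm => Or.inl hm⟩
  | cons T L ih =>
    intro acc h
    obtain ⟨acc', g, h₁⟩ := affineImages_spec _ (Nat.pred_lt hp.ne') _ h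
    obtain ⟨tab, g, h₂⟩ := ih _ g
    refine ⟨tab, g, fun m hm => ?_⟩
    rcases h₂ m hm with hm | ⟨T', hT', hm⟩
    · exact (h₁ m hm).imp_right fun h => ⟨T, List.mem_cons_self, h⟩
    · exact Or.inr ⟨T', List.mem_cons_of_mem _ hT', hm⟩

/-! ### The check for a given prime -/

/-- The mask `M` belongs to the list `L`. -/
noncomputable def isListed (M : ℕ) (L : List ℕ) : Bool :=
  @List.rec _ (fun _ => Bool) false
    (fun m _ ih => @Bool.rec (fun _ => Bool) ih true (Nat.beq m M)) L

theorem isListed_spec {M : ℕ} (L : List ℕ) (h : isListed M L = true) : M ∈ L := by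
  induction L with
  | nil => exact absurd h (by simp [isListed])
  | cons m L ih =>
    cases hb : Nat.beq m M with
    | true => exact List.mem_cons.2 (Or.inl (Nat.eq_of_beq_eq_true hb).symm)
    | false =>
      replace h : @Bool.rec (fun _ => Bool) (isListed M L) true (Nat.beq m M) = true := h
      rw [hb] at h
      exact List.mem_cons_of_mem _ (ih h)

/-- The test for a complete set: its palette graph contains no linked set, or it is listed. -/
noncomputable def leafTest (tab : List ℕ) (M : ℕ) (E : List (ℕ × ℕ)) : Bool :=
  @Bool.rec (fun _ => Bool) (isListed M tab) true (refutes 20 E)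

/-- The check for the sets with `n + 3` elements containing `0`, `1` and `2`. -/
noncomputable def checkAP (p n : ℕ) (L : List (List ℕ)) : Bool :=
  allAffineImages p (fun tab =>
    extend p false 0 (extend p false 1 (extend p false 2
      (search p false (leafTest tab) p n))) [] 0 [] 0) L []

/-- The check for the sets with `n + 2` elements containing `0` and `1` that have no arithmetic
progressions. -/
noncomputable def checkNoAP (p n : ℕ) : Bool :=
  extend p true 0 (extend p true 1 (search p true (leafTest []) p n)) [] 0 [] 0

/-- Transport along `ZMod.val`. Loops are not recorded in `E`, but no set separates their ends. -/
theorem HasLinkedPalette.linked {p : ℕ} [NeZero p] {S : Set (ZMod p)} (h : HasLinkedPalette S)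
    {E : List (ℕ × ℕ)} (hE : ∀ a₁ ∈ S, ∀ a₂ ∈ S, ∀ a₃ ∈ S, ∀ a₄ ∈ S, a₁ + a₃ = a₂ + a₄ →
      a₁ + a₂ ≠ a₃ + a₄ → maskEdge (a₁ + a₂) (a₃ + a₄) (a₁ + a₃) ∈ E) :
    ∃ V : Set ℕ, V.Nontrivial ∧ Linked E V := by
  obtain ⟨V, hV, h⟩ := h
  refine ⟨ZMod.val '' V, hV.image (ZMod.val_injective p), fun A hA => ?_⟩
  refine (h (ZMod.val ⁻¹' A) ?_).imp (fun h => Set.image_subset_iff.2 h) fun h => ?_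
  · intro a₁ h₁ a₂ h₂ a₃ h₃ a₄ h₄ hs v₁ v₂ v₃
    by_cases hne : a₁ + a₂ = a₃ + a₄
    · rw [hne]
    · have hb₁ : bits (maskEdge (a₁ + a₂) (a₃ + a₄) (a₁ + a₃)).1 =
          {(a₁ + a₂).val, (a₃ + a₄).val} := by
        rw [maskEdge, bits_lor, bits_shiftLeft, bits_shiftLeft]; rfl
      have hb₂ : bits (maskEdge (a₁ + a₂) (a₃ + a₄) (a₁ + a₃)).2 = {(a₁ + a₃).val} := by
        rw [maskEdge, bits_shiftLeft]
      have := hA _ (hE a₁ h₁ a₂ h₂ a₃ h₃ a₄ h₄ hs hne)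
      rw [hb₁, hb₂] at this
      rcases this (Set.pair_subset ⟨_, v₁, rfl⟩ ⟨_, v₂, rfl⟩)
        (Set.singleton_subset_iff.2 ⟨_, v₃, rfl⟩) (Set.singleton_nonempty _) with hA | hA
      · exact iff_of_true (hA (by simp)) (hA (by simp))
      · exact iff_of_false (Set.disjoint_left.1 hA (by simp)) (Set.disjoint_left.1 hA (by simp))
  · rw [Set.disjoint_left]
    rintro _ ⟨v, hv, rfl⟩
    exact Set.disjoint_left.1 h hv

theorem leafTest_spec {p : ℕ} [NeZero p] {Q : Finset (ZMod p) → Prop} {tab : List ℕ}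
    (hQ : ∀ S : Finset (ZMod p), ¬ HasLinkedPalette (S : Set (ZMod p)) → Q S)
    (htab : ∀ S : Finset (ZMod p), ∀ M ∈ tab, IsMask M (S : Set (ZMod p)) → Q S)
    (S : Finset (ZMod p)) (T : List ℕ) (M : ℕ) (E : List (ℕ × ℕ)) (F : ℕ)
    (hS : SearchState Q S T M E F) (h : leafTest tab M E = true) : Q S := by
  -- If depth 20 is not enough for a refutation, the set still has to be in the table.
  cases hr : refutes 20 E with
  | true =>
    refine hQ S fun hl => ?_
    obtain ⟨V, hV, hl⟩ := hl.linked hS.edges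
    exact not_linked_of_refutes hr hV hl
  | false =>
    rw [leafTest, hr] at h
    exact htab S M (isListed_spec tab h) hS.isMask

theorem checkNoAP_spec {p n : ℕ} [Fact (1 < p)] (hodd : Odd p) (h : checkNoAP p n = true)
    (S : Finset (ZMod p)) (h₀ : 0 ∈ S) (h₁ : 1 ∈ S) (hc : S.card = n + 2) :
    HasThreeAP (S : Set (ZMod p)) ∨ ¬ HasLinkedPalette (S : Set (ZMod p)) := by
  have hp : 1 < p := Fact.out
  have : NeZero p := ⟨by lia⟩
  let Q : Finset (ZMod p) → Prop := fun S =>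
    HasThreeAP (S : Set (ZMod p)) ∨ ¬ HasLinkedPalette (S : Set (ZMod p))
  have hQ : true = true → ∀ S : Finset (ZMod p), HasThreeAP (S : Set (ZMod p)) → Q S :=
    fun _ S hS => Or.inl hS
  obtain ⟨T, M, E, F, g, hs⟩ := extend_spec (x := (0 : ZMod p)) hodd hQ (SearchState.empty Q)
    (by simp) (by rw [ZMod.val_zero]; exact h)
  obtain ⟨T, M, E, F, g, hs⟩ := extend_spec (x := (1 : ZMod p)) hodd hQ hs (by simp)
    (by rw [ZMod.val_one]; exact g)
  refine search_spec hodd hQ (leafTest_spec (fun S hS => Or.inr hS) (by simp)) p le_rfl n _ T M E F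
    g hs S (by simp [Finset.insert_subset_iff, h₀, h₁]) ?_ fun y _ _ => y.val_lt
  rw [hc, Finset.card_insert_of_notMem (by simp), add_comm]
  simp

theorem checkAP_spec {p n : ℕ} [Fact p.Prime] (hodd : Odd p) {L : List (List ℕ)}
    (h : checkAP p n L = true) (S : Finset (ZMod p)) (h₀ : 0 ∈ S) (h₁ : 1 ∈ S) (h₂ : 2 ∈ S)
    (hc : S.card = n + 3) : ¬ HasLinkedPalette (S : Set (ZMod p)) ∨
      ∃ T ∈ L, ∃ (s : (ZMod p)ˣ) (t : ZMod p),
        (S : Set (ZMod p)) = (fun a => (s : ZMod p) * a + t) '' {x | ∃ a ∈ T, (a : ZMod p) = x} := by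
  have hp : p.Prime := Fact.out
  have hp₂ : 2 < p := by
    rcases hp.two_le.lt_or_eq with h | rfl
    · exact h
    · exact absurd hodd (by decide)
  have : Fact (1 < p) := ⟨by lia⟩
  have v₂ : (2 : ZMod p).val = 2 := ZMod.val_cast_of_lt (a := 2) hp₂
  let Q : Finset (ZMod p) → Prop := fun S => ¬ HasLinkedPalette (S : Set (ZMod p)) ∨
      ∃ T ∈ L, ∃ (s : (ZMod p)ˣ) (t : ZMod p),
        (S : Set (ZMod p)) = (fun a => (s : ZMod p) * a + t) '' {x | ∃ a ∈ T, (a : ZMod p) = x}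
  have hQ : false = true → ∀ S : Finset (ZMod p), HasThreeAP (S : Set (ZMod p)) → Q S := by simp
  obtain ⟨tab, g, htab⟩ := allAffineImages_spec hp.pos L [] h
  have n₁ : (1 : ZMod p) ∉ insert 0 (∅ : Finset (ZMod p)) := by simp
  have n₂ : (2 : ZMod p) ∉ insert 1 (insert 0 (∅ : Finset (ZMod p))) := by
    simp only [insert_empty_eq, Finset.mem_insert, Finset.mem_singleton, not_or]
    refine ⟨fun e => ?_, fun e => ?_⟩ <;> apply_fun ZMod.val at e
    · rw [v₂, ZMod.val_one] at e; lia
    · rw [v₂, ZMod.val_zero] at e; lia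
  obtain ⟨T, M, E, F, g, hs⟩ := extend_spec (x := (0 : ZMod p)) hodd hQ (SearchState.empty Q)
    (by simp) (by rw [ZMod.val_zero]; exact g)
  obtain ⟨T, M, E, F, g, hs⟩ := extend_spec (x := (1 : ZMod p)) hodd hQ hs n₁
    (by rw [ZMod.val_one]; exact g)
  obtain ⟨T, M, E, F, g, hs⟩ := extend_spec (x := (2 : ZMod p)) hodd hQ hs n₂ (by rw [v₂]; exact g)
  refine search_spec hodd hQ (leafTest_spec (fun S hS => Or.inl hS) ?_) p le_rfl n _ T M E F
    g hs S (by simp [Finset.insert_subset_iff, h₀, h₁, h₂]) ?_ fun y _ _ => y.val_lt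
  · intro S M hM hS
    rcases htab M hM with hM | ⟨T, hT, i, j, hi, hip, hM⟩
    · simp at hM
    · have hne : (i : ZMod p) ≠ 0 := by
        rw [ne_eq, ZMod.natCast_eq_zero_iff]
        exact Nat.not_dvd_of_pos_of_lt hi hip
      refine Or.inr ⟨T, hT, Units.mk0 (i : ZMod p) hne, j, ?_⟩
      ext y
      rw [← hS y, hM]
      constructor
      · rintro ⟨a, ha, hy⟩
        refine ⟨a, ⟨a, ha, rfl⟩, ZMod.val_injective p ?_⟩
        rw [← hy, ← ZMod.val_natCast]
        simp
      · rintro ⟨_, ⟨a, ha, rfl⟩, rfl⟩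
        refine ⟨a, ha, ?_⟩
        rw [← ZMod.val_natCast]
        simp
  · rw [hc, Finset.card_insert_of_notMem n₂, Finset.card_insert_of_notMem n₁, add_comm]
    simp

/-! ### Linked palettes -/

/-- The residue classes of the members of a list. -/
def residues (p : ℕ) (T : List ℕ) : Set (ZMod p) := {x | ∃ a ∈ T, (a : ZMod p) = x}

theorem residues_nil (p : ℕ) : residues p [] = ∅ := by simp [residues]

theorem residues_cons (p a : ℕ) (T : List ℕ) :
    residues p (a :: T) = insert (a : ZMod p) (residues p T) := by
  ext x
  change (∃ b ∈ a :: T, (b : ZMod p) = x) ↔ x = a ∨ ∃ b ∈ T, (b : ZMod p) = x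
  simp [eq_comm]

/-- The same `V` works, since `S'` has all the edges of `S`. -/
theorem HasLinkedPalette.mono {p : ℕ} {S S' : Set (ZMod p)} (h : HasLinkedPalette S)
    (hS : S ⊆ S') : HasLinkedPalette S' := by
  obtain ⟨V, hV, h⟩ := h
  exact ⟨V, hV, fun A hA => h A fun a₁ h₁ a₂ h₂ a₃ h₃ a₄ h₄ =>
    hA a₁ (hS h₁) a₂ (hS h₂) a₃ (hS h₃) a₄ (hS h₄)⟩

theorem HasLinkedPalette.image {p : ℕ} {S : Set (ZMod p)} (h : HasLinkedPalette S)
    (s : (ZMod p)ˣ) (t : ZMod p) :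
    HasLinkedPalette ((fun a => (s : ZMod p) * a + t) '' S) := by
  obtain ⟨V, hV, h⟩ := h
  -- Vertices and labels are sums of two elements, so they are shifted by `t` twice.
  let ψ : ZMod p → ZMod p := fun b => (s : ZMod p) * b + (t + t)
  have hadd : ∀ a b : ZMod p, (s : ZMod p) * a + t + (s * b + t) = ψ (a + b) := fun a b => by
    simp only [ψ]; ring
  have hψ : Function.Injective ψ := fun a b hab => s.isUnit.mul_left_cancel (add_right_cancel hab)
  refine ⟨ψ '' V, hV.image hψ, fun A hA => ?_⟩
  refine (h (ψ ⁻¹' A) ?_).imp (fun h => Set.image_subset_iff.2 h) fun h => ?_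
  · intro a₁ h₁ a₂ h₂ a₃ h₃ a₄ h₄ hs v₁ v₂ v₃
    have := hA _ ⟨a₁, h₁, rfl⟩ _ ⟨a₂, h₂, rfl⟩ _ ⟨a₃, h₃, rfl⟩ _ ⟨a₄, h₄, rfl⟩
    simp only [hadd, hs] at this
    exact this trivial ⟨_, v₁, rfl⟩ ⟨_, v₂, rfl⟩ ⟨_, hs ▸ v₃, rfl⟩
  · rw [Set.disjoint_left]
    rintro _ ⟨v, hv, rfl⟩
    exact Set.disjoint_left.1 h hv

theorem HasThreeAP.image {p : ℕ} {S : Set (ZMod p)} (h : HasThreeAP S) (s : (ZMod p)ˣ)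
    (t : ZMod p) : HasThreeAP ((fun a => (s : ZMod p) * a + t) '' S) := by
  obtain ⟨a, ha, b, hb, c, hc, hab, h⟩ := h
  refine ⟨_, ⟨a, ha, rfl⟩, _, ⟨b, hb, rfl⟩, _, ⟨c, hc, rfl⟩, fun e => hab ?_, ?_⟩
  · exact s.isUnit.mul_left_cancel (add_right_cancel e)
  · linear_combination (s : ZMod p) * h

/-! ### Affine normalization -/

theorem AffineEquivalent.symm {p : ℕ} {S S' : Set (ZMod p)} (h : AffineEquivalent S S') :
    AffineEquivalent S' S := by
  obtain ⟨s, t, rfl⟩ := h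
  refine ⟨s⁻¹, -(↑s⁻¹ * t), ?_⟩
  rw [Set.image_image]
  simp [mul_add]

theorem AffineEquivalent.trans {p : ℕ} {S S' S'' : Set (ZMod p)} (h : AffineEquivalent S S')
    (h' : AffineEquivalent S' S'') : AffineEquivalent S S'' := by
  obtain ⟨s, t, rfl⟩ := h
  obtain ⟨s', t', rfl⟩ := h'
  refine ⟨s' * s, s' * t + t', ?_⟩
  rw [Set.image_image]
  congr 1
  funext a
  push_cast
  ring

/-- An affine map that sends two given elements to `0` and `1`. -/
theorem exists_affine_zero_one {p : ℕ} [Fact p.Prime] {a b : ZMod p} (hab : a ≠ b) :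
    ∃ (s : (ZMod p)ˣ) (t : ZMod p), (s : ZMod p) * a + t = 0 ∧ (s : ZMod p) * b + t = 1 := by
  have h : b - a ≠ 0 := sub_ne_zero.2 hab.symm
  refine ⟨(Units.mk0 _ h)⁻¹, -((b - a)⁻¹ * a), by simp, ?_⟩
  rw [Units.val_inv_eq_inv_val, Units.val_mk0]
  field_simp
  ring

theorem ncard_affine_image {p : ℕ} (S : Set (ZMod p)) (s : (ZMod p)ˣ) (t : ZMod p) :
    ((fun a => (s : ZMod p) * a + t) '' S).ncard = S.ncard :=
  Set.ncard_image_of_injective _ fun _ _ h => s.isUnit.mul_left_cancel (add_right_cancel h)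

/-- A set without arithmetic progressions and with the given number of elements has no linked
palette. -/
theorem not_hasLinkedPalette_of_checkNoAP {p n : ℕ} [Fact p.Prime] (hodd : Odd p)
    (h : checkNoAP p n = true) {S : Set (ZMod p)} (hS : S.ncard = n + 2)
    (hAP : ¬ HasThreeAP S) : ¬ HasLinkedPalette S := by
  classical
  intro hl
  have : Fact (1 < p) := ⟨(Fact.out : p.Prime).one_lt⟩
  obtain ⟨a, ha, b, hb, hab⟩ := Set.one_lt_ncard_iff_nontrivial.1 (by lia : 1 < S.ncard)
  obtain ⟨s, t, h₀, h₁⟩ := exists_affine_zero_one hab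
  have hc := ncard_affine_image S s t
  have hl' := hl.image s t
  have ha' : (0 : ZMod p) ∈ (fun a => (s : ZMod p) * a + t) '' S := ⟨a, ha, h₀⟩
  have hb' : (1 : ZMod p) ∈ (fun a => (s : ZMod p) * a + t) '' S := ⟨b, hb, h₁⟩
  have hAP' : ¬ HasThreeAP ((fun a => (s : ZMod p) * a + t) '' S) := fun h => by
    obtain ⟨s', t', hS'⟩ := AffineEquivalent.symm (S := S) ⟨s, t, rfl⟩
    apply hAP
    rw [hS']
    exact h.image s' t'
  obtain ⟨S', hS'⟩ := ((fun a => (s : ZMod p) * a + t) '' S).toFinite.exists_finset_coe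
  rw [← hS'] at hc hl' ha' hb' hAP'
  rw [Set.ncard_coe_finset, hS] at hc
  exact (checkNoAP_spec hodd h S' ha' hb' hc).elim hAP' fun h => h hl'

/-- The sets with `m` elements that have a linked palette are affine equivalent to those in `L`. -/
def LinkedPalettesListed (p m : ℕ) (L : List (List ℕ)) : Prop :=
  ∀ S : Set (ZMod p), S.ncard = m → HasLinkedPalette S →
    ∃ T ∈ L, AffineEquivalent S (residues p T)

/-- Both checks concern sets of `n + 3` elements: one fixes three of them, the other only two, hence
`n` and `n + 1`. -/
theorem linkedPalettesListed_of_checks {p n : ℕ} {L : List (List ℕ)} [Fact p.Prime] (hodd : Odd p)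
    (h₁ : checkAP p n L = true) (h₂ : checkNoAP p (n + 1) = true) :
    LinkedPalettesListed p (n + 3) L := by
  classical
  intro S hS hl
  by_cases hAP : HasThreeAP S
  · obtain ⟨a, ha, b, hb, c, hc, hab, habc⟩ := hAP
    obtain ⟨s, t, e₀, e₁⟩ := exists_affine_zero_one hab
    have e₂ : (s : ZMod p) * c + t = 2 := by
      linear_combination (s : ZMod p) * habc - e₀ + 2 * e₁
    have hcard := ncard_affine_image S s t
    have hl' := hl.image s t
    have ha' : (0 : ZMod p) ∈ (fun a => (s : ZMod p) * a + t) '' S := ⟨a, ha, e₀⟩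
    have hb' : (1 : ZMod p) ∈ (fun a => (s : ZMod p) * a + t) '' S := ⟨b, hb, e₁⟩
    have hc' : (2 : ZMod p) ∈ (fun a => (s : ZMod p) * a + t) '' S := ⟨c, hc, e₂⟩
    obtain ⟨S', hS'⟩ := ((fun a => (s : ZMod p) * a + t) '' S).toFinite.exists_finset_coe
    have hS₁ : AffineEquivalent S (S' : Set (ZMod p)) := ⟨s, t, hS'⟩
    rw [← hS'] at hcard hl' ha' hb' hc'
    rw [Set.ncard_coe_finset, hS] at hcard
    rcases checkAP_spec hodd h₁ S' ha' hb' hc' hcard with h | ⟨T, hT, h⟩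
    · exact absurd hl' h
    · exact ⟨T, hT, hS₁.trans (AffineEquivalent.symm h)⟩
  · exact absurd hl (not_hasLinkedPalette_of_checkNoAP hodd h₂ hS hAP)

/-- Take the vertices of the subgraph as `V`. If `a₁ + a₃ = a₂ + a₄`, the label, half the sum of the
ends, is `a₁ + a₃`; the other kind of edge reduces to this by exchanging `a₃` and `a₄`.
Connectedness then propagates membership in `A`. -/
theorem HasConnectedRSubgraph.hasLinkedPalette {p : ℕ} (hp : IsUnit (2 : ZMod p))
    {S : Set (ZMod p)} (h : HasConnectedRSubgraph S) : HasLinkedPalette S := by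
  obtain ⟨H, hR, hH, hc⟩ := h
  refine ⟨Subtype.val '' H.verts, ?_, fun A hA => ?_⟩
  · have := (Set.finite_of_ncard_pos (by lia : 0 < H.verts.ncard)).to_subtype
    exact (Set.one_lt_ncard_iff_nontrivial.1 (by lia)).image Subtype.val_injective
  · have hadj : ∀ b₁ b₂, H.Adj b₁ b₂ → ((b₁ : ZMod p) ∈ A ↔ (b₂ : ZMod p) ∈ A) := by
      intro b₁ b₂ hb
      obtain ⟨b, hbH, hb'⟩ := hR b₁ b₂ hb
      have v₁ := Set.mem_image_of_mem Subtype.val (H.edge_vert hb)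
      have v₂ := Set.mem_image_of_mem Subtype.val (H.edge_vert hb.symm)
      have v₃ := Set.mem_image_of_mem Subtype.val hbH
      have label : ∀ a₁ a₂ a₃ a₄ : ZMod p, a₁ + a₃ = a₂ + a₄ →
          2⁻¹ * (a₁ + a₂ + (a₃ + a₄)) = a₁ + a₃ := fun a₁ a₂ a₃ a₄ h => by
        have : a₁ + a₂ + (a₃ + a₄) = 2 * (a₁ + a₃) := by linear_combination -h
        rw [this, ← mul_assoc, ZMod.inv_mul_of_unit _ hp, one_mul]
      obtain ⟨-, a₁, h₁, a₂, h₂, a₃, h₃, a₄, h₄, e₁, e₂, hs⟩ := H.adj_sub hb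
      rw [← e₁] at v₁ hb' ⊢
      rw [← e₂] at v₂ hb' ⊢
      rw [hb'] at v₃
      rcases hs with hs | hs
      · rw [label _ _ _ _ hs] at v₃
        exact hA a₁ h₁ a₂ h₂ a₃ h₃ a₄ h₄ hs v₁ v₂ v₃
      · rw [add_comm a₃] at v₂ v₃ ⊢
        rw [label _ _ _ _ hs] at v₃
        exact hA a₁ h₁ a₂ h₂ a₄ h₄ a₃ h₃ hs v₁ v₂ v₃
    have hall : ∀ b₁ b₂ : H.verts, ((b₁ : paletteVertices S) : ZMod p) ∈ A →
        ((b₂ : paletteVertices S) : ZMod p) ∈ A := by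
      intro b₁ b₂ h
      have := (SimpleGraph.reachable_iff_reflTransGen b₁ b₂).1 (hH.coe.preconnected b₁ b₂)
      induction this with
      | refl => exact h
      | tail _ hb ih => exact (hadj _ _ hb).1 ih
    by_cases hne : ∃ b : H.verts, ((b : paletteVertices S) : ZMod p) ∈ A
    · obtain ⟨b, hb⟩ := hne
      left
      rintro _ ⟨b', hb', rfl⟩
      exact hall b ⟨b', hb'⟩ hb
    · right
      rw [Set.disjoint_left]
      rintro _ ⟨b', hb', rfl⟩ h
      exact hne ⟨⟨b', hb'⟩, h⟩

/-! ### From Dehn colorings to linked palettes -/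

namespace KnotDiagram

open Dart

/-- The sum of the colors on the two sides of an end. -/
def dartColor (D : KnotDiagram) {p : ℕ} (C : D.Region → ZMod p) (d : Dart D.crossings) : ZMod p :=
  C (D.regionAt d) + C (D.regionAt (rot.symm d))

theorem regionAt_faceNext (D : KnotDiagram) (d : Dart D.crossings) :
    D.regionAt (faceNext D.glue d) = D.regionAt d :=
  congrArg Sum.inl (Quotient.sound (s := Equiv.Perm.SameCycle.setoid (faceNext D.glue))
    (Equiv.Perm.SameCycle.rfl.apply_left))

/-- The two ends of a semiarc border the same two regions, with left and right exchanged. -/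
theorem dartColor_glue (D : KnotDiagram) {p : ℕ} (C : D.Region → ZMod p) (d : Dart D.crossings) :
    D.dartColor C (D.glue d) = D.dartColor C d := by
  have h₁ : faceNext D.glue (D.glue d) = rot.symm d := by
    rw [faceNext, Equiv.trans_apply, D.glue_glue]
  have h₂ : faceNext D.glue d = rot.symm (D.glue d) := rfl
  rw [dartColor, dartColor, ← h₁, ← h₂, regionAt_faceNext, regionAt_faceNext, add_comm]

theorem IsNontrivialDehnColoring.hasLinkedPalette {D : KnotDiagram} {p : ℕ}
    (hp : IsUnit (2 : ZMod p)) {C : D.Region → ZMod p} (h : D.IsNontrivialDehnColoring C) :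
    HasLinkedPalette (Set.range C) := by
  obtain ⟨hC, hn⟩ := h
  have f₀ : ∀ c, D.dartColor C (c, 0) = C (D.x₁ c) + C (D.x₂ c) := fun c => rfl
  have f₁ : ∀ c, D.dartColor C (c, 1) = C (D.x₁ c) + C (D.x₃ c) := fun c => add_comm _ _
  have f₂ : ∀ c, D.dartColor C (c, 2) = C (D.x₃ c) + C (D.x₄ c) := fun c => add_comm _ _
  have f₃ : ∀ c, D.dartColor C (c, 3) = C (D.x₂ c) + C (D.x₄ c) := fun c => rfl
  refine ⟨Set.range (D.dartColor C), ?_, fun A hA => ?_⟩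
  -- At a nontrivial crossing the under-ends have different sums: otherwise adding and subtracting
  -- the Dehn relation and cancelling 2 makes the crossing trivial.
  · obtain ⟨c, hc⟩ := not_forall.1 hn
    refine ⟨_, ⟨(c, 0), rfl⟩, _, ⟨(c, 2), rfl⟩, fun e => hc ?_⟩
    rw [f₀, f₂] at e
    have hCc := hC c
    constructor
    · exact hp.mul_left_cancel (by linear_combination e + hCc)
    · exact hp.mul_left_cancel (by linear_combination hCc - e)
  · have hopp : ∀ d, D.dartColor C d ∈ A → D.dartColor C (opp d) ∈ A := by
      rintro ⟨c, i⟩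
      have key := hA _ ⟨D.x₁ c, rfl⟩ _ ⟨D.x₂ c, rfl⟩ _ ⟨D.x₃ c, rfl⟩ _ ⟨D.x₄ c, rfl⟩ (hC c)
        ⟨(c, 0), f₀ c⟩ ⟨(c, 2), f₂ c⟩ ⟨(c, 1), f₁ c⟩
      rw [← f₀, ← f₂] at key
      have hover : D.dartColor C (c, 1) = D.dartColor C (c, 3) := by rw [f₁, f₃, hC]
      have e₂ : (2 + 1 + 1 : ZMod 4) = 0 := by decide
      have e₃ : (3 + 1 + 1 : ZMod 4) = 1 := by decide
      have hi : ∀ i : ZMod 4, i = 0 ∨ i = 1 ∨ i = 2 ∨ i = 3 := by decide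
      rw [show opp ((c, i) : Dart D.crossings) = (c, i + 1 + 1) from rfl]
      rcases hi i with rfl | rfl | rfl | rfl
      · exact key.1
      · exact fun h => hover ▸ h
      · rw [e₂]; exact key.2
      · rw [e₃]; exact fun h => hover.symm ▸ h
    -- The single component enters here: one walk along the knot reaches every end.
    have hall : ∀ d d', D.dartColor C d ∈ A → D.dartColor C d' ∈ A := by
      intro d d' h
      induction D.one_component d d' with
      | refl => exact h
      | tail _ hb ih =>
        rcases hb with rfl | rfl
        · rwa [dartColor_glue]
        · exact hopp _ ih
    by_cases hne : ∃ d, D.dartColor C d ∈ A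
    · obtain ⟨d, hd⟩ := hne
      left
      rintro _ ⟨d', rfl⟩
      exact hall d d' hd
    · right
      rw [Set.disjoint_left]
      rintro _ ⟨d', rfl⟩ h
      exact hne ⟨d', h⟩

end KnotDiagram

/-! ### Lower bounds -/

theorem isUnit_two_of_odd {p : ℕ} (hodd : Odd p) : IsUnit (2 : ZMod p) := by
  have := (ZMod.isUnit_iff_coprime 2 p).2 (Nat.coprime_two_left.2 hodd)
  exact_mod_cast this

/-- Smaller sets are padded to exactly `m` elements, which monotonicity permits. -/
theorem not_hasLinkedPalette_of_ncard_le {p m : ℕ} [NeZero p] (hm : m ≤ p)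
    (h : LinkedPalettesListed p m []) {S : Set (ZMod p)} (hS : S.ncard ≤ m) :
    ¬ HasLinkedPalette S := by
  intro hl
  obtain ⟨S₁, rfl⟩ := S.toFinite.exists_finset_coe
  rw [Set.ncard_coe_finset] at hS
  obtain ⟨S', hSS', hc⟩ := Finset.exists_superset_card_eq hS (by rwa [ZMod.card])
  obtain ⟨T, hT, -⟩ := h S' (by rw [Set.ncard_coe_finset, hc])
    (hl.mono (Finset.coe_subset.2 hSS'))
  simp at hT

theorem palette_lower_bounds {p m : ℕ} (hodd : Odd p) (hm : m ≤ p)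
    (h : LinkedPalettesListed p m []) :
    (¬ ∃ S : Set (ZMod p), S.ncard ≤ m ∧ HasConnectedRSubgraph S) ∧
      ∀ K : Knot, K.IsDehnColorable p → m + 1 ≤ K.mincolDehn p := by
  have : NeZero p := ⟨hodd.pos.ne'⟩
  have h2 := isUnit_two_of_odd hodd
  constructor
  · rintro ⟨S, hS, hR⟩
    exact not_hasLinkedPalette_of_ncard_le hm h hS (hR.hasLinkedPalette h2)
  · rintro K ⟨D, hD, C, hC⟩
    refine le_csInf ⟨_, D, hD, C, hC, rfl⟩ ?_
    rintro _ ⟨D, -, C, hC, rfl⟩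
    by_contra hlt
    exact not_hasLinkedPalette_of_ncard_le hm h (by lia) (hC.hasLinkedPalette h2)

/-! ### The individual primes -/

instance fact_prime_five : Fact (Nat.Prime 5) := ⟨by norm_num⟩

instance fact_prime_seven : Fact (Nat.Prime 7) := ⟨by norm_num⟩

instance fact_prime_eleven : Fact (Nat.Prime 11) := ⟨by norm_num⟩

instance fact_prime_thirteen : Fact (Nat.Prime 13) := ⟨by norm_num⟩

instance fact_prime_seventeen : Fact (Nat.Prime 17) := ⟨by norm_num⟩

instance fact_prime_nineteen : Fact (Nat.Prime 19) := ⟨by norm_num⟩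

instance fact_prime_twentythree : Fact (Nat.Prime 23) := ⟨by norm_num⟩

instance fact_prime_twentynine : Fact (Nat.Prime 29) := ⟨by norm_num⟩

instance fact_prime_thirtyone : Fact (Nat.Prime 31) := ⟨by norm_num⟩

/-- Two elements contain no three-term progression, so only the progression-free check is needed;
the combined criterion starts at three elements. -/
theorem linkedPalettesListed_three_two : LinkedPalettesListed 3 2 [] :=
  fun S hS hl => absurd hl (not_hasLinkedPalette_of_checkNoAP (n := 0) (by decide)
    (by decide +kernel) hS fun ⟨a, ha, b, hb, c, hc, hab, h⟩ => by
      obtain ⟨x, y, -, rfl⟩ := Set.ncard_eq_two.1 hS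
      have key : ∀ x y a b c : ZMod 3, (a = x ∨ a = y) → (b = x ∨ b = y) → (c = x ∨ c = y) →
          a ≠ b → a + c ≠ b + b := by decide
      exact key x y a b c ha hb hc hab h)

theorem linkedPalettesListed_three_three : LinkedPalettesListed 3 3 [[0, 1, 2]] :=
  linkedPalettesListed_of_checks (by decide) (by decide +kernel) (by decide +kernel)

theorem linkedPalettesListed_five_three : LinkedPalettesListed 5 3 [] :=
  linkedPalettesListed_of_checks (by decide) (by decide +kernel) (by decide +kernel)

theorem linkedPalettesListed_five_four : LinkedPalettesListed 5 4 [[0, 1, 2, 3]] :=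
  linkedPalettesListed_of_checks (by decide) (by decide +kernel) (by decide +kernel)

theorem linkedPalettesListed_seven_three : LinkedPalettesListed 7 3 [] :=
  linkedPalettesListed_of_checks (by decide) (by decide +kernel) (by decide +kernel)

theorem linkedPalettesListed_seven_four : LinkedPalettesListed 7 4 [[0, 1, 2, 4]] :=
  linkedPalettesListed_of_checks (by decide) (by decide +kernel) (by decide +kernel)

theorem linkedPalettesListed_eleven_four : LinkedPalettesListed 11 4 [] :=
  linkedPalettesListed_of_checks (by decide) (by decide +kernel) (by decide +kernel)

theorem linkedPalettesListed_eleven_five :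
    LinkedPalettesListed 11 5 [[0, 1, 2, 3, 6], [0, 1, 2, 4, 7]] :=
  linkedPalettesListed_of_checks (by decide) (by decide +kernel) (by decide +kernel)

theorem linkedPalettesListed_thirteen_four : LinkedPalettesListed 13 4 [] :=
  linkedPalettesListed_of_checks (by decide) (by decide +kernel) (by decide +kernel)

theorem linkedPalettesListed_thirteen_five : LinkedPalettesListed 13 5 [[0, 1, 2, 4, 7]] :=
  linkedPalettesListed_of_checks (by decide) (by decide +kernel) (by decide +kernel)

theorem linkedPalettesListed_seventeen_five : LinkedPalettesListed 17 5 [] :=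
  linkedPalettesListed_of_checks (by decide) (by decide +kernel) (by decide +kernel)

theorem linkedPalettesListed_seventeen_six : LinkedPalettesListed 17 6
    [[0, 1, 2, 3, 5, 9], [0, 1, 2, 3, 5, 10], [0, 1, 2, 3, 5, 12],
    [0, 1, 2, 3, 6, 9], [0, 1, 2, 3, 6, 10], [0, 1, 2, 3, 6, 11],
    [0, 1, 2, 3, 6, 13], [0, 1, 2, 3, 7, 11], [0, 1, 2, 4, 5, 9],
    [0, 1, 2, 4, 5, 10], [0, 1, 2, 4, 5, 12], [0, 1, 2, 4, 10, 13]] :=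
  linkedPalettesListed_of_checks (by decide) (by decide +kernel) (by decide +kernel)

theorem linkedPalettesListed_nineteen_five : LinkedPalettesListed 19 5 [] :=
  linkedPalettesListed_of_checks (by decide) (by decide +kernel) (by decide +kernel)

theorem linkedPalettesListed_nineteen_six : LinkedPalettesListed 19 6
    [[0, 1, 2, 3, 5, 10], [0, 1, 2, 3, 6, 10], [0, 1, 2, 3, 6, 11],
    [0, 1, 2, 3, 6, 12], [0, 1, 2, 3, 6, 13], [0, 1, 2, 3, 6, 14],
    [0, 1, 2, 3, 7, 12], [0, 1, 2, 4, 5, 10], [0, 1, 2, 4, 5, 14],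
    [0, 1, 2, 4, 7, 12], [0, 1, 2, 4, 7, 15]] :=
  linkedPalettesListed_of_checks (by decide) (by decide +kernel) (by decide +kernel)

theorem linkedPalettesListed_twentythree_five : LinkedPalettesListed 23 5 [] :=
  linkedPalettesListed_of_checks (by decide) (by decide +kernel) (by decide +kernel)

theorem linkedPalettesListed_twentythree_six : LinkedPalettesListed 23 6
    [[0, 1, 2, 3, 6, 12], [0, 1, 2, 4, 7, 12], [0, 1, 2, 4, 7, 13],
    [0, 1, 2, 4, 7, 14], [0, 1, 2, 4, 9, 14], [0, 1, 2, 4, 10, 19]] :=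
  linkedPalettesListed_of_checks (by decide) (by decide +kernel) (by decide +kernel)

theorem linkedPalettesListed_twentynine_five : LinkedPalettesListed 29 5 [] :=
  linkedPalettesListed_of_checks (by decide) (by decide +kernel) (by decide +kernel)

theorem linkedPalettesListed_twentynine_six : LinkedPalettesListed 29 6 [[0, 1, 2, 4, 8, 15]] :=
  linkedPalettesListed_of_checks (by decide) (by decide +kernel) (by decide +kernel)

theorem linkedPalettesListed_thirtyone_five : LinkedPalettesListed 31 5 [] :=
  linkedPalettesListed_of_checks (by decide) (by decide +kernel) (by decide +kernel)

theorem linkedPalettesListed_thirtyone_six : LinkedPalettesListed 31 6 [[0, 1, 2, 4, 8, 16]] :=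
  linkedPalettesListed_of_checks (by decide) (by decide +kernel) (by decide +kernel)

theorem mainTheorem3 (p : ℕ) (hp : p.Prime) (hodd : Odd p) (hlt : p < 2 ^ 5) :
    ((¬ ∃ S : Set (ZMod p), S.ncard ≤ Nat.log 2 p + 1 ∧ HasConnectedRSubgraph S) ∧
      ∀ K : Knot, K.IsDehnColorable p → Nat.log 2 p + 2 ≤ K.mincolDehn p) ∧
    ∀ (D : KnotDiagram) (C : D.Region → ZMod p), D.IsNontrivialDehnColoring C →
      (Set.range C).ncard = Nat.log 2 p + 2 →
      ((p = 3 → AffineEquivalent (Set.range C) {0, 1, 2}) ∧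
       (p = 5 → AffineEquivalent (Set.range C) {0, 1, 2, 3}) ∧
       (p = 7 → AffineEquivalent (Set.range C) {0, 1, 2, 4}) ∧
       (p = 11 →
          AffineEquivalent (Set.range C) {0, 1, 2, 3, 6} ∨
          AffineEquivalent (Set.range C) {0, 1, 2, 4, 7}) ∧
       (p = 13 → AffineEquivalent (Set.range C) {0, 1, 2, 4, 7}) ∧
       (p = 17 →
          AffineEquivalent (Set.range C) {0, 1, 2, 3, 5, 9} ∨
          AffineEquivalent (Set.range C) {0, 1, 2, 3, 5, 10} ∨
          AffineEquivalent (Set.range C) {0, 1, 2, 3, 5, 12} ∨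
          AffineEquivalent (Set.range C) {0, 1, 2, 3, 6, 9} ∨
          AffineEquivalent (Set.range C) {0, 1, 2, 3, 6, 10} ∨
          AffineEquivalent (Set.range C) {0, 1, 2, 3, 6, 11} ∨
          AffineEquivalent (Set.range C) {0, 1, 2, 3, 6, 13} ∨
          AffineEquivalent (Set.range C) {0, 1, 2, 3, 7, 11} ∨
          AffineEquivalent (Set.range C) {0, 1, 2, 4, 5, 9} ∨
          AffineEquivalent (Set.range C) {0, 1, 2, 4, 5, 10} ∨
          AffineEquivalent (Set.range C) {0, 1, 2, 4, 5, 12} ∨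
          AffineEquivalent (Set.range C) {0, 1, 2, 4, 10, 13}) ∧
       (p = 19 →
          AffineEquivalent (Set.range C) {0, 1, 2, 3, 5, 10} ∨
          AffineEquivalent (Set.range C) {0, 1, 2, 3, 6, 10} ∨
          AffineEquivalent (Set.range C) {0, 1, 2, 3, 6, 11} ∨
          AffineEquivalent (Set.range C) {0, 1, 2, 3, 6, 12} ∨
          AffineEquivalent (Set.range C) {0, 1, 2, 3, 6, 13} ∨
          AffineEquivalent (Set.range C) {0, 1, 2, 3, 6, 14} ∨
          AffineEquivalent (Set.range C) {0, 1, 2, 3, 7, 12} ∨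
          AffineEquivalent (Set.range C) {0, 1, 2, 4, 5, 10} ∨
          AffineEquivalent (Set.range C) {0, 1, 2, 4, 5, 14} ∨
          AffineEquivalent (Set.range C) {0, 1, 2, 4, 7, 12} ∨
          AffineEquivalent (Set.range C) {0, 1, 2, 4, 7, 15}) ∧
       (p = 23 →
          AffineEquivalent (Set.range C) {0, 1, 2, 3, 6, 12} ∨
          AffineEquivalent (Set.range C) {0, 1, 2, 4, 7, 12} ∨
          AffineEquivalent (Set.range C) {0, 1, 2, 4, 7, 13} ∨
          AffineEquivalent (Set.range C) {0, 1, 2, 4, 7, 14} ∨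
          AffineEquivalent (Set.range C) {0, 1, 2, 4, 9, 14} ∨
          AffineEquivalent (Set.range C) {0, 1, 2, 4, 10, 19}) ∧
       (p = 29 → AffineEquivalent (Set.range C) {0, 1, 2, 4, 8, 15}) ∧
       (p = 31 → AffineEquivalent (Set.range C) {0, 1, 2, 4, 8, 16})) := by
  have conclude : ∀ {m : ℕ} {L : List (List ℕ)}, LinkedPalettesListed p m L →
      ∀ (D : KnotDiagram) (C : D.Region → ZMod p), D.IsNontrivialDehnColoring C →
        (Set.range C).ncard = m → ∃ T ∈ L, AffineEquivalent (Set.range C) (residues p T) :=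
    fun h D C hC hm => h _ hm (hC.hasLinkedPalette (isUnit_two_of_odd hodd))
  refine ⟨?_, fun D C hC hm => ⟨?_, ?_, ?_, ?_, ?_, ?_, ?_, ?_, ?_, ?_⟩⟩
  · have hp₂ := hp.two_le
    -- For numeral `p` the size `Nat.log 2 p + 1` evaluates to 2 for 3, to 3 for 5 and 7, to 4 for
    -- 11 and 13, and to 5 for the larger primes.
    interval_cases p
    · exact absurd hodd (by decide)
    · exact palette_lower_bounds hodd (by decide) linkedPalettesListed_three_two
    · exact absurd hp (by norm_num)
    · exact palette_lower_bounds hodd (by decide) linkedPalettesListed_five_three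
    · exact absurd hp (by norm_num)
    · exact palette_lower_bounds hodd (by decide) linkedPalettesListed_seven_three
    · exact absurd hp (by norm_num)
    · exact absurd hp (by norm_num)
    · exact absurd hp (by norm_num)
    · exact palette_lower_bounds hodd (by decide) linkedPalettesListed_eleven_four
    · exact absurd hp (by norm_num)
    · exact palette_lower_bounds hodd (by decide) linkedPalettesListed_thirteen_four
    · exact absurd hp (by norm_num)
    · exact absurd hp (by norm_num)
    · exact absurd hp (by norm_num)
    · exact palette_lower_bounds hodd (by decide) linkedPalettesListed_seventeen_five
    · exact absurd hp (by norm_num)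
    · exact palette_lower_bounds hodd (by decide) linkedPalettesListed_nineteen_five
    · exact absurd hp (by norm_num)
    · exact absurd hp (by norm_num)
    · exact absurd hp (by norm_num)
    · exact palette_lower_bounds hodd (by decide) linkedPalettesListed_twentythree_five
    · exact absurd hp (by norm_num)
    · exact absurd hp (by norm_num)
    · exact absurd hp (by norm_num)
    · exact absurd hp (by norm_num)
    · exact absurd hp (by norm_num)
    · exact palette_lower_bounds hodd (by decide) linkedPalettesListed_twentynine_five
    · exact absurd hp (by norm_num)
    · exact palette_lower_bounds hodd (by decide) linkedPalettesListed_thirtyone_five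
  · rintro rfl
    simpa [residues_cons, residues_nil] using
      conclude linkedPalettesListed_three_three D C hC hm
  · rintro rfl
    simpa [residues_cons, residues_nil] using
      conclude linkedPalettesListed_five_four D C hC hm
  · rintro rfl
    simpa [residues_cons, residues_nil] using
      conclude linkedPalettesListed_seven_four D C hC hm
  · rintro rfl
    simpa [residues_cons, residues_nil] using
      conclude linkedPalettesListed_eleven_five D C hC hm
  · rintro rfl
    simpa [residues_cons, residues_nil] using
      conclude linkedPalettesListed_thirteen_five D C hC hm
  · rintro rfl
    simpa [residues_cons, residues_nil] using
      conclude linkedPalettesListed_seventeen_six D C hC hm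
  · rintro rfl
    simpa [residues_cons, residues_nil] using
      conclude linkedPalettesListed_nineteen_six D C hC hm
  · rintro rfl
    simpa [residues_cons, residues_nil] using
      conclude linkedPalettesListed_twentythree_six D C hC hm
  · rintro rfl
    simpa [residues_cons, residues_nil] using
      conclude linkedPalettesListed_twentynine_six D C hC hm
  · rintro rfl
    simpa [residues_cons, residues_nil] using
      conclude linkedPalettesListed_thirtyone_six D C hC hm
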